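/- Let $N\ge 2$, $T>0$ and $\mu,\nu\ge 0$. A triple $(v,b,p)$ is called a weak solution of the magnetohydrodynamic equations $$\partial_t v+(v\cdot\nabla)v=(b\cdot\nabla)b-\nabla\big(p+\tfrac12|b|^2\big)+\nu\Delta v,\qquad \partial_t b+(v\cdot\nabla)b=(b\cdot\nabla)v+\mu\Delta b,\qquad \operatorname{div}v=\operatorname{div}b=0$$ on $\mathbb R^N\times(0,T)$ if $v,b\in L^1(0,T;L^2_\sigma(\mathbb R^N))$ (the $L^2$ vector fields whose distributional divergence is $0$), $p\in L^1(0,T;\mathcal S'(\mathbb R^N))$ (that is, $t\mapsto\langle p(t),\psi\rangle$ is integrable on $(0,T)$ for every Schwartz function $\psi$), and for all $\phi\in[C_c^\infty(\mathbb R^N)]^N$ and $\xi\in C_c^1(0,T)$ the integrals below exist (each integral over space existing for a.e. $t$ and, multiplied by $\xi$ or $\xi'$, being integrable in $t$) and $$-\int_0^T\!\!\int v\cdot\phi\,\xi'\,dx\,dt-\int_0^T\!\!\int v\otimes v:\nabla\phi\,\xi\,dx\,dt=-\int_0^T\!\!\int b\otimes b:\nabla\phi\,\xi\,dx\,dt+\int_0^T\langle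 p(t),\operatorname{div}\phi\rangle\,\xi\,dt+\frac12\int_0^T\!\!\int|b|^2\operatorname{div}\phi\,\xi\,dx\,dt+\nu\int_0^T\!\!\int v\cdot\Delta\phi\,\xi\,dx\,dt,$$ $$-\int_0^T\!\!\int b\cdot\phi\,\xi'\,dx\,dt-\int_0^T\!\!\int v\otimes b:\nabla\phi\,\xi\,dx\,dt=-\int_0^T\!\!\int b\otimes v:\nabla\phi\,\xi\,dx\,dt+\mu\int_0^T\!\!\int b\cdot\Delta\phi\,\xi\,dx\,dt,$$ where $(a\otimes c)_{ij}=a_ic_j$, $(\nabla\phi)_{ij}=\partial_i\phi^j$ and $A:B=\sum_{i,j}A_{ij}B_{ij}$. Fix a Schwartz function $\eta$ on $\mathbb R^N$ with $\int\eta\,dx\ne0$, put $\eta_s(x)=s^{-N}\eta(x/s)$, and for $0<q\le1$ let $\mathcal H^q(\mathbb R^N)$ be the Hardy space of all $f\in\mathcal S'(\mathbb R^N)$ with $\|f\|_{\mathcal H^q}:=\big\|\sup_{s>0}|f*\eta_s|\big\|_{L^q}<\infty$. Let $(v,b,p)$ be a weak solution of the magnetohydrodynamic equations on $\mathbb R^N\times(0,T)$,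 and suppose that either $p\in L^1(0,T;L^1(\mathbb R^N))$ and $\int_{\mathbb R^N}p(x,t)\,dx\ge0$ for a.e. $t\in(0,T)$, or $p\in L^1(0,T;\mathcal H^q(\mathbb R^N))$ for some $q\in(0,1]$. If $N\ge3$, then $v=b=0$ a.e. in $\mathbb R^N\times(0,T)$. If $N=2$, then $v=0$ a.e. in $\mathbb R^2\times(0,T)$, $\int_{\mathbb R^2}(b^1(x,t))^2dx=\int_{\mathbb R^2}(b^2(x,t))^2dx$ for a.e. $t\in(0,T)$, and $b$ is a weak solution of the heat equation $\partial_tb=\mu\Delta b$, that is, $$-\int_0^T\!\!\int_{\mathbb R^2} b\cdot\phi\,\xi'\,dx\,dt=\mu\int_0^T\!\!\int_{\mathbb R^2} b\cdot\Delta\phi\,\xi\,dx\,dt\qquad\text{for all }\phi\in[C_c^\infty(\mathbb R^2)]^2,\ \xi\in C_c^1(0,T).$$ -/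

import Mathlib

open MeasureTheory Set
open scoped SchwartzMap ENNReal ContDiff

noncomputable section

namespace MHD

/-- The Euclidean space `ℝ^N`. -/
abbrev Sp (N : ℕ) : Type := EuclideanSpace ℝ (Fin N)

/-- Real tempered distributions on `ℝ^N`. -/
abbrev Distr (N : ℕ) : Type := 𝓢(Sp N, ℝ) →L[ℝ] ℝ

variable {N : ℕ}

/-! ### Test functions and differential operators -/

/-- Vector test functions: `φ ∈ [C_c^∞(ℝ^N)]^N`. -/
structure IsSpaceTest (φ : Sp N → Sp N) : Prop where
  contDiff : ContDiff ℝ ∞ φ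
  compact : HasCompactSupport φ

/-- Test functions in time: `ξ ∈ C_c^1(0,T)`. -/
structure IsTimeTest (T : ℝ) (ξ : ℝ → ℝ) : Prop where
  contDiff : ContDiff ℝ 1 ξ
  compact : HasCompactSupport ξ
  supp : tsupport ξ ⊆ Ioo 0 T

/-- The matrix entry `(∇φ)_{ij} = ∂_i φ^j`. -/
def pd (i j : Fin N) (φ : Sp N → Sp N) (x : Sp N) : ℝ :=
  (fderiv ℝ φ x (EuclideanSpace.single i 1)) j

/-- The divergence `div φ = ∑_i ∂_i φ^i`. -/
def divg (φ : Sp N → Sp N) (x : Sp N) : ℝ := ∑ i, pd i i φ x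

theorem contDiff_divg {φ : Sp N → Sp N} (hφ : IsSpaceTest φ) : ContDiff ℝ ∞ (divg φ) := by
  have h1 : ContDiff ℝ ∞ (fderiv ℝ φ) := hφ.contDiff.fderiv_right (by simp)
  refine ContDiff.sum fun i _ => ?_
  have h2 : ContDiff ℝ ∞ (fun x => fderiv ℝ φ x (EuclideanSpace.single i 1)) :=
    h1.clm_apply contDiff_const
  exact (EuclideanSpace.proj (𝕜 := ℝ) i : Sp N →L[ℝ] ℝ).contDiff.comp h2

theorem hasCompactSupport_divg {φ : Sp N → Sp N} (hφ : IsSpaceTest φ) :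
    HasCompactSupport (divg φ) := by
  refine (hφ.compact.fderiv (𝕜 := ℝ)).mono ?_
  intro x hx h0
  apply hx
  simp [divg, pd, h0]

/-- `div φ` as a Schwartz function, so that it can be paired with a tempered distribution. -/
def divS {φ : Sp N → Sp N} (hφ : IsSpaceTest φ) : 𝓢(Sp N, ℝ) :=
  (hasCompactSupport_divg hφ).toSchwartzMap (contDiff_divg hφ)

/-! ### Function spaces -/

/-- `u ∈ L^1(0,T; L^2_σ(ℝ^N))`; the divergence vanishes in the sense of distributions. -/
structure MemL1L2σ (T : ℝ) (u : ℝ → Sp N → Sp N) : Prop where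
  meas : AEStronglyMeasurable (Function.uncurry u)
    ((volume.restrict (Ioo 0 T)).prod volume)
  memL2 : ∀ᵐ t ∂(volume.restrict (Ioo 0 T)), MemLp (u t) 2 volume
  normL1 : ∫⁻ t in Ioo 0 T, eLpNorm (u t) 2 volume < ⊤
  div_free : ∀ᵐ t ∂(volume.restrict (Ioo 0 T)), ∀ ψ : Sp N → ℝ, ContDiff ℝ ∞ ψ →
    HasCompactSupport ψ → ∫ x, inner ℝ (u t x) (gradient ψ x) = 0

/-- `p ∈ L^1(0,T; 𝓢')`: every pairing `t ↦ ⟨p(t), ψ⟩` is integrable on `(0,T)`. -/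
def MemL1Distr (T : ℝ) (p : ℝ → Distr N) : Prop :=
  ∀ ψ : 𝓢(Sp N, ℝ), IntegrableOn (fun t => p t ψ) (Ioo 0 T)

/-- `p ∈ L^1(0,T; L^1(ℝ^N))` with `∫ p(x,t) dx ≥ 0` for a.e. `t ∈ (0,T)`: for a.e. `t` the
distribution `p(t)` is given by an integrable function `g(t)`. -/
def MemL1L1Plus (T : ℝ) (p : ℝ → Distr N) : Prop :=
  ∃ g : ℝ → Sp N → ℝ,
    Integrable (Function.uncurry g) ((volume.restrict (Ioo 0 T)).prod volume) ∧
    (∀ᵐ t ∂(volume.restrict (Ioo 0 T)), ∀ ψ : 𝓢(Sp N, ℝ), p t ψ = ∫ x, g t x * ψ x) ∧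
    ∀ᵐ t ∂(volume.restrict (Ioo 0 T)), 0 ≤ ∫ x, g t x

/-- The Schwartz function `y ↦ η_s(x - y)`, where `η_s(z) = s^{-N} η(z / s)` and `s > 0`. -/
def kernelS (η : 𝓢(Sp N, ℝ)) (s : ℝ) (hs : 0 < s) (x : Sp N) : 𝓢(Sp N, ℝ) :=
  (s ^ N)⁻¹ • SchwartzMap.compSubConstCLM ℝ x
    (SchwartzMap.compCLMOfContinuousLinearEquiv ℝ
      (ContinuousLinearEquiv.smulLeft (Units.mk0 (-s⁻¹) (neg_ne_zero.mpr (inv_ne_zero hs.ne')))) η)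

theorem kernelS_apply (η : 𝓢(Sp N, ℝ)) (s : ℝ) (hs : 0 < s) (x y : Sp N) :
    kernelS η s hs x y = (s ^ N)⁻¹ * η (s⁻¹ • (x - y)) := by
  have : (-s⁻¹) • (y - x) = s⁻¹ • (x - y) := by rw [neg_smul, ← smul_neg, neg_sub]
  rw [← this]
  rfl

/-- The maximal function `M_η f(x) = sup_{s>0} |(f * η_s)(x)|`. -/
def maximalFn (η : 𝓢(Sp N, ℝ)) (f : Distr N) (x : Sp N) : ℝ≥0∞ :=
  ⨆ (s : ℝ) (hs : 0 < s), ENNReal.ofReal |f (kernelS η s hs x)|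

/-- The quasi-norm `‖f‖_{𝓗^q} = ‖M_η f‖_{L^q}`. -/
def hardyNorm (η : 𝓢(Sp N, ℝ)) (q : ℝ) (f : Distr N) : ℝ≥0∞ :=
  (∫⁻ x, maximalFn η f x ^ q) ^ (1 / q)

/-- `p ∈ L^1(0,T; 𝓗^q(ℝ^N))`, where the Hardy space is the set of tempered distributions `f`
with `M_η f ∈ L^q`. -/
structure MemL1Hardy (η : 𝓢(Sp N, ℝ)) (q T : ℝ) (p : ℝ → Distr N) : Prop where
  mem : ∀ᵐ t ∂(volume.restrict (Ioo 0 T)), hardyNorm η q (p t) < ⊤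
  meas : AEMeasurable (fun t => hardyNorm η q (p t)) (volume.restrict (Ioo 0 T))
  normL1 : ∫⁻ t in Ioo 0 T, hardyNorm η q (p t) < ⊤

/-! ### Weak solutions -/

/-- `∫ u(x,t) · φ(x) dx`. -/
def pair (u : ℝ → Sp N → Sp N) (φ : Sp N → Sp N) (t : ℝ) : ℝ :=
  ∫ x, inner ℝ (u t x) (φ x)

/-- `∫ u(x,t) ⊗ w(x,t) : ∇φ(x) dx`. -/
def tens (u w : ℝ → Sp N → Sp N) (φ : Sp N → Sp N) (t : ℝ) : ℝ :=
  ∫ x, ∑ i, ∑ j, u t x i * w t x j * pd i j φ x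

/-- `∫ |b(x,t)|² div φ(x) dx`. -/
def magn (b : ℝ → Sp N → Sp N) (φ : Sp N → Sp N) (t : ℝ) : ℝ :=
  ∫ x, ‖b t x‖ ^ 2 * divg φ x

/-- Weak solutions `(v,b,p)` of the MHD equations on `ℝ^N × (0,T)`. The fields
`int_vv, ..., int_magn` say that the quadratic integrals in the two identities exist; all the
other integrals exist by the first three fields. -/
structure IsWeakSolution (μ ν T : ℝ) (v b : ℝ → Sp N → Sp N) (p : ℝ → Distr N) : Prop where
  mem_v : MemL1L2σ T v
  mem_b : MemL1L2σ T b
  mem_p : MemL1Distr T p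
  int_vv : ∀ φ ξ, IsSpaceTest φ → IsTimeTest T ξ →
    IntegrableOn (fun t => tens v v φ t * ξ t) (Ioo 0 T)
  int_bb : ∀ φ ξ, IsSpaceTest φ → IsTimeTest T ξ →
    IntegrableOn (fun t => tens b b φ t * ξ t) (Ioo 0 T)
  int_vb : ∀ φ ξ, IsSpaceTest φ → IsTimeTest T ξ →
    IntegrableOn (fun t => tens v b φ t * ξ t) (Ioo 0 T)
  int_bv : ∀ φ ξ, IsSpaceTest φ → IsTimeTest T ξ →
    IntegrableOn (fun t => tens b v φ t * ξ t) (Ioo 0 T)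
  int_magn : ∀ φ ξ, IsSpaceTest φ → IsTimeTest T ξ →
    IntegrableOn (fun t => magn b φ t * ξ t) (Ioo 0 T)
  momentum : ∀ φ ξ, ∀ hφ : IsSpaceTest φ, IsTimeTest T ξ →
    -(∫ t in Ioo 0 T, pair v φ t * deriv ξ t) - (∫ t in Ioo 0 T, tens v v φ t * ξ t) =
      -(∫ t in Ioo 0 T, tens b b φ t * ξ t)
      + (∫ t in Ioo 0 T, p t (divS hφ) * ξ t)
      + 1 / 2 * (∫ t in Ioo 0 T, magn b φ t * ξ t)
      + ν * (∫ t in Ioo 0 T, pair v (Laplacian.laplacian φ) t * ξ t)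
  induction_eq : ∀ φ ξ, IsSpaceTest φ → IsTimeTest T ξ →
    -(∫ t in Ioo 0 T, pair b φ t * deriv ξ t) - (∫ t in Ioo 0 T, tens v b φ t * ξ t) =
      -(∫ t in Ioo 0 T, tens b v φ t * ξ t)
      + μ * (∫ t in Ioo 0 T, pair b (Laplacian.laplacian φ) t * ξ t)

/-- `b ∈ L^1(0,T; L^2_σ)` is a weak solution of the heat equation `∂_t b = μ Δ b` on
`ℝ^N × (0,T)`. -/
structure IsWeakHeatSolution (μ T : ℝ) (b : ℝ → Sp N → Sp N) : Prop where
  mem : MemL1L2σ T b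
  heat : ∀ φ ξ, IsSpaceTest φ → IsTimeTest T ξ →
    -(∫ t in Ioo 0 T, pair b φ t * deriv ξ t) =
      μ * (∫ t in Ioo 0 T, pair b (Laplacian.laplacian φ) t * ξ t)

end MHD

end

noncomputable section

open Filter Topology LineDeriv Laplacian

namespace MHD

/-! ### Schwartz functions: translates, smeared distributions, truncation. -/

section Schwartz

variable {E : Type*} [NormedAddCommGroup E] [NormedSpace ℝ E]

/-! Testing the momentum equation with a gradient `∇ψ` removes the time derivative and the viscous
term, because `v` is divergence free. A variation in time then leaves, for a.e. `t`, `⟨p, Δψ⟩ = -∑ ∫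
F_ij ∂_i∂_jψ`, where `F = v ⊗ v - b ⊗ b + ½|b|² I` is integrable in space
(`IsWeakSolution.pressure_eq`). The point is to show that all diagonal integrals `∫ F_kk` equal one
number `-c` with `c ≥ 0`. Summing over `k` gives `‖v‖² + (N-2)/2 ‖b‖² = -Nc ≤ 0`, so `v = 0`, and `b
= 0` if `N ≥ 3`. For `N = 2` the individual diagonal entries give the equality of the two components
of `b`, and `v = 0` turns the induction equation into the heat equation.

If `p` is an integrable function `g`, the equation is tested with dilates of a cutoff of `x_k²`. At
large scales an integrable function acts like its total mass at the origin, which gives `c = ∫ g`.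

If `p` lies in a Hardy space, put `U_s(x) = s^N (p * η_s)(s x)`. The functions `ΔU_s` are bounded
uniformly in `s` and converge to `-∑ (∫ F_ij) ∂_i∂_jη`. Since `q ≤ 1`, the integral of `|U_s|^q`
over `|x| > a` is at most that of the `q`-th power of the maximal function over `|y| > sa`, which
tends to zero. A mean value argument (`exists_uniform_bound`) bounds `U_s` uniformly, so `U_s → 0`
as a distribution and `∑ (∫ F_ij) ∂_i∂_jη = 0` (`sum_integral_mul_hess_eq_zero`). Testing this with
dilated local squares gives `(∫ F_kk)(∫ η) = 0`, hence `c = 0`. -/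

theorem lineDerivOp_comm (g : 𝓢(E, ℝ)) (a b : E) : ∂_{a} (∂_{b} g) = ∂_{b} (∂_{a} g) := by
  ext x
  have hs : IsSymmSndFDerivAt ℝ g x :=
    (g.smooth 2).contDiffAt.isSymmSndFDerivAt (by simp)
  have hd : DifferentiableAt ℝ (fderiv ℝ g) x :=
    ((g.smooth 2).fderiv_right (m := 1) (by norm_num)).differentiable (by simp) x
  have key : ∀ a b : E, (∂_{a} (∂_{b} g) : 𝓢(E, ℝ)) x = fderiv ℝ (fderiv ℝ g) x a b := by
    intro a b
    rw [SchwartzMap.lineDerivOp_apply_eq_fderiv]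
    change fderiv ℝ (fun y => fderiv ℝ g y b) x a = _
    rw [fderiv_clm_apply hd (by fun_prop)]
    simp
  rw [key, key, hs.eq]

theorem iteratedLineDerivOp_lineDerivOp_comm (g : 𝓢(E, ℝ)) {n : ℕ} (m : Fin n → E) (h : E) :
    ∂^{m} (∂_{h} g) = ∂_{h} (∂^{m} g) := by
  induction n with
  | zero => simp
  | succ n ih =>
    rw [iteratedLineDerivOp_succ_left, ih, iteratedLineDerivOp_succ_left, lineDerivOp_comm]

theorem iteratedFDeriv_lineDerivOp (g : 𝓢(E, ℝ)) (n : ℕ) (h y : E) :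
    iteratedFDeriv ℝ n (∂_{h} g : 𝓢(E, ℝ)) y = fderiv ℝ (iteratedFDeriv ℝ n g) y h := by
  ext m
  rw [← SchwartzMap.iteratedLineDerivOp_eq_iteratedFDeriv, iteratedLineDerivOp_lineDerivOp_comm,
    SchwartzMap.lineDerivOp_apply_eq_fderiv,
    ← fderiv_continuousMultilinear_apply_const_apply]
  · simp only [← SchwartzMap.iteratedLineDerivOp_eq_iteratedFDeriv]
  · exact (g.smooth ⊤).differentiable_iteratedFDeriv (mod_cast ENat.natCast_lt_top n) y

theorem exists_one_add_norm_pow_mul_iteratedFDeriv_le (g : 𝓢(E, ℝ)) (k n : ℕ) :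
    ∃ C, 0 ≤ C ∧ ∀ x, (1 + ‖x‖) ^ k * ‖iteratedFDeriv ℝ n g x‖ ≤ C :=
  ⟨_, by positivity, fun x => SchwartzMap.one_add_le_sup_seminorm_apply (𝕜 := ℝ)
    (m := (k, n)) le_rfl le_rfl g x⟩

/-- The first order Taylor remainder of a translation is quadratically small in every seminorm. -/
theorem exists_seminorm_translate_sub_le (g : 𝓢(E, ℝ)) (k n : ℕ) :
    ∃ C, 0 ≤ C ∧ ∀ h : E, ‖h‖ ≤ 1 →
      SchwartzMap.seminorm ℝ k n (SchwartzMap.compSubConstCLM ℝ h g - g + ∂_{h} g)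
        ≤ C * ‖h‖ ^ 2 := by
  obtain ⟨C, hC0, hC⟩ := exists_one_add_norm_pow_mul_iteratedFDeriv_le g k (n + 2)
  refine ⟨2 ^ k * C, by positivity, fun h hh => ?_⟩
  refine SchwartzMap.seminorm_le_bound ℝ k n _ (by positivity) fun y => ?_
  set B := 2 ^ k * C / (1 + ‖y‖) ^ k with hB
  have hB0 : 0 ≤ B := by positivity
  have h2 : ∀ z ∈ Metric.closedBall y ‖h‖, ‖iteratedFDeriv ℝ (n + 2) g z‖ ≤ B := by
    intro z hz
    rw [Metric.mem_closedBall, dist_eq_norm] at hz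
    -- The point `z` is within distance 1 of `y`, so the weights at both points are comparable; this
    -- is the source of the factor `2 ^ k`.
    have h3 : 1 + ‖y‖ ≤ 2 * (1 + ‖z‖) := by
      have := norm_sub_norm_le y z
      rw [norm_sub_rev] at this
      linarith [norm_nonneg z]
    rw [hB, le_div_iff₀ (by positivity)]
    calc _ ≤ ‖iteratedFDeriv ℝ (n + 2) g z‖ * (2 * (1 + ‖z‖)) ^ k := by gcongr
      _ = 2 ^ k * ((1 + ‖z‖) ^ k * ‖iteratedFDeriv ℝ (n + 2) g z‖) := by rw [mul_pow]; ring
      _ ≤ 2 ^ k * C := by gcongr; exact hC z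
  have hdiff : ∀ m : ℕ, Differentiable ℝ (iteratedFDeriv ℝ m g) := fun m =>
    (g.smooth ⊤).differentiable_iteratedFDeriv (mod_cast ENat.natCast_lt_top m)
  have h1 : ∀ z ∈ Metric.closedBall y ‖h‖,
      ‖fderiv ℝ (iteratedFDeriv ℝ n g) z - fderiv ℝ (iteratedFDeriv ℝ n g) y‖ ≤ B * ‖h‖ := by
    intro z hz
    have e1 : ‖fderiv ℝ (iteratedFDeriv ℝ n g) z - fderiv ℝ (iteratedFDeriv ℝ n g) y‖ =
        ‖iteratedFDeriv ℝ (n + 1) g z - iteratedFDeriv ℝ (n + 1) g y‖ := by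
      rw [iteratedFDeriv_succ_eq_comp_left]
      rw [← dist_eq_norm]
      have e2 := (continuousMultilinearCurryLeftEquiv ℝ (fun _ : Fin (n + 1) => E) ℝ).symm.dist_map
        (fderiv ℝ (iteratedFDeriv ℝ n g) z) (fderiv ℝ (iteratedFDeriv ℝ n g) y)
      exact (dist_eq_norm (fderiv ℝ (iteratedFDeriv ℝ n g) z) _).symm.trans e2.symm
    rw [e1]
    have := (convex_closedBall y ‖h‖).norm_image_sub_le_of_norm_fderiv_le (𝕜 := ℝ)
      (f := iteratedFDeriv ℝ (n + 1) g) (C := B) (fun x _ => hdiff _ x)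
      (fun x hx => by rw [norm_fderiv_iteratedFDeriv]; exact h2 x hx)
      (Metric.mem_closedBall_self (norm_nonneg h)) hz
    refine this.trans ?_
    gcongr
    rwa [Metric.mem_closedBall, dist_eq_norm] at hz
  have h0 := (convex_closedBall y ‖h‖).norm_image_sub_le_of_norm_fderiv_le' (𝕜 := ℝ)
      (f := iteratedFDeriv ℝ n g) (C := B * ‖h‖) (φ := fderiv ℝ (iteratedFDeriv ℝ n g) y)
      (fun x _ => hdiff _ x) h1
      (Metric.mem_closedBall_self (norm_nonneg h)) (y := y - h) (by simp)
  have e0 : iteratedFDeriv ℝ n (SchwartzMap.compSubConstCLM ℝ h g - g + ∂_{h} g : 𝓢(E, ℝ)) y =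
      iteratedFDeriv ℝ n g (y - h) - iteratedFDeriv ℝ n g y
        - fderiv ℝ (iteratedFDeriv ℝ n g) y (y - h - y) := by
    have s1 : ∀ f : 𝓢(E, ℝ), ContDiffAt ℝ n f y := fun f => (f.smooth n).contDiffAt
    have : ((SchwartzMap.compSubConstCLM ℝ h g - g + ∂_{h} g : 𝓢(E, ℝ)) : E → ℝ) =
        ((fun z => g (z - h)) - ⇑g) + ⇑(∂_{h} g : 𝓢(E, ℝ)) := by
      ext z; simp
    have s2 : ContDiffAt ℝ n (fun z => g (z - h)) y :=
      ((g.smooth n).comp (contDiff_id.sub contDiff_const)).contDiffAt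
    have s3 : ContDiffAt ℝ n ((fun z => g (z - h)) - ⇑g) y := s2.sub (s1 g)
    rw [this, iteratedFDeriv_add_apply s3 (s1 _), iteratedFDeriv_sub_apply s2 (s1 g),
      iteratedFDeriv_comp_sub, iteratedFDeriv_lineDerivOp]
    simp
  rw [e0]
  have hy : ‖y - h - y‖ = ‖h‖ := by simp
  rw [hy] at h0
  calc _ ≤ (1 + ‖y‖) ^ k * (B * ‖h‖ * ‖h‖) := by
        gcongr
        linarith
    _ = _ := by rw [hB]; field_simp

/-- A continuous functional is controlled by finitely many Schwartz seminorms, so the constants can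
be summed over that finite set, uniformly in the index. -/
theorem exists_forall_abs_le_of_seminorm_le (f : 𝓢(E, ℝ) →L[ℝ] ℝ) {ι : Type*} (P : ι → 𝓢(E, ℝ))
    (w : ι → ℝ) (hP : ∀ k n, ∃ C, 0 ≤ C ∧ ∀ i, SchwartzMap.seminorm ℝ k n (P i) ≤ C * w i)
    (hw : ∀ i, 0 ≤ w i) :
    ∃ C, 0 ≤ C ∧ ∀ i, |f (P i)| ≤ C * w i := by
  obtain ⟨s, C, -, h⟩ := Seminorm.bound_of_continuous (schwartz_withSeminorms ℝ E ℝ)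
    ((normSeminorm ℝ ℝ).comp f.toLinearMap) (by exact continuous_norm.comp f.continuous)
  choose c hc0 hc using hP
  refine ⟨C * ∑ a ∈ s, c a.1 a.2,
    mul_nonneg C.2 (Finset.sum_nonneg fun a _ => hc0 _ _), fun i => ?_⟩
  have h1 := h (P i)
  have h2 : (s.sup (schwartzSeminormFamily ℝ E ℝ)) (P i) ≤ (∑ a ∈ s, c a.1 a.2) * w i := by
    refine Seminorm.finset_sup_apply_le ?_ fun a ha => ?_
    · exact mul_nonneg (Finset.sum_nonneg fun a _ => hc0 _ _) (hw i)
    · refine (hc a.1 a.2 i).trans ?_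
      gcongr
      · exact hw i
      · exact Finset.single_le_sum (f := fun a : ℕ × ℕ => c a.1 a.2) (fun a _ => hc0 _ _) ha
  calc |f (P i)| ≤ C * (s.sup (schwartzSeminormFamily ℝ E ℝ)) (P i) := h1
    _ ≤ C * ((∑ a ∈ s, c a.1 a.2) * w i) := by gcongr
    _ = _ := by ring

/-- The function `x ↦ ⟨f, g(· - x)⟩`. -/
def smear (f : 𝓢(E, ℝ) →L[ℝ] ℝ) (g : 𝓢(E, ℝ)) (x : E) : ℝ :=
  f (SchwartzMap.compSubConstCLM ℝ x g)

/-- The inequality `‖y‖ ≤ (1 + ‖x‖)(1 + ‖y - x‖)` moves the Schwartz weight of a translate onto `x`,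
and only finitely many seminorms matter. This polynomial growth is the a priori information needed
in `exists_uniform_bound`. -/
theorem exists_smear_le (f : 𝓢(E, ℝ) →L[ℝ] ℝ) (g : 𝓢(E, ℝ)) :
    ∃ (A : ℝ) (m : ℕ), 0 ≤ A ∧ ∀ x, |smear f g x| ≤ A * (1 + ‖x‖) ^ m := by
  obtain ⟨s, C, -, h⟩ := Seminorm.bound_of_continuous (schwartz_withSeminorms ℝ E ℝ)
    ((normSeminorm ℝ ℝ).comp f.toLinearMap) (by exact continuous_norm.comp f.continuous)
  choose c hc0 hc using exists_one_add_norm_pow_mul_iteratedFDeriv_le g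
  set m := s.sup Prod.fst
  refine ⟨C * ∑ a ∈ s, c a.1 a.2, m,
    mul_nonneg C.2 (Finset.sum_nonneg fun a _ => hc0 _ _), fun x => ?_⟩
  have h2 : (s.sup (schwartzSeminormFamily ℝ E ℝ)) (SchwartzMap.compSubConstCLM ℝ x g) ≤
      (∑ a ∈ s, c a.1 a.2) * (1 + ‖x‖) ^ m := by
    refine Seminorm.finset_sup_apply_le ?_ fun a ha => ?_
    · exact mul_nonneg (Finset.sum_nonneg fun a _ => hc0 _ _) (by positivity)
    · refine SchwartzMap.seminorm_le_bound ℝ a.1 a.2 _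
        (mul_nonneg (Finset.sum_nonneg fun a _ => hc0 _ _) (by positivity)) fun y => ?_
      have e : ((SchwartzMap.compSubConstCLM ℝ x g : 𝓢(E, ℝ)) : E → ℝ) = fun z => g (z - x) := by
        ext z; simp
      rw [e, iteratedFDeriv_comp_sub]
      have h3 : ‖y‖ ≤ (1 + ‖x‖) * (1 + ‖y - x‖) := by
        have := norm_sub_norm_le y x
        nlinarith [norm_nonneg x, norm_nonneg (y - x)]
      calc _ ≤ ((1 + ‖x‖) * (1 + ‖y - x‖)) ^ a.1 * ‖iteratedFDeriv ℝ a.2 g (y - x)‖ := by gcongr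
        _ = (1 + ‖x‖) ^ a.1 * ((1 + ‖y - x‖) ^ a.1 * ‖iteratedFDeriv ℝ a.2 g (y - x)‖) := by
            rw [mul_pow]; ring
        _ ≤ (1 + ‖x‖) ^ m * c a.1 a.2 := by
            gcongr
            · linarith [norm_nonneg x]
            · exact Finset.le_sup (f := Prod.fst) ha
            · exact hc _ _ _
        _ ≤ (1 + ‖x‖) ^ m * ∑ a ∈ s, c a.1 a.2 := by
            gcongr
            exact Finset.single_le_sum (f := fun a : ℕ × ℕ => c a.1 a.2) (fun a _ => hc0 _ _) ha
        _ = _ := mul_comm _ _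
  calc |smear f g x| ≤ C * (s.sup (schwartzSeminormFamily ℝ E ℝ)) _ := h _
    _ ≤ C * ((∑ a ∈ s, c a.1 a.2) * (1 + ‖x‖) ^ m) := by gcongr
    _ = _ := by ring

theorem isBigO_smear_sub (f : 𝓢(E, ℝ) →L[ℝ] ℝ) (g : 𝓢(E, ℝ)) (x : E) :
    ∃ C, 0 ≤ C ∧ ∀ h : E, ‖h‖ ≤ 1 →
      |smear f g (x + h) - smear f g x + smear f (∂_{h} g) x| ≤ C * ‖h‖ ^ 2 := by
  obtain ⟨C, hC0, hC⟩ := exists_forall_abs_le_of_seminorm_le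
    (f.comp (SchwartzMap.compSubConstCLM ℝ x)) (ι := {h : E // ‖h‖ ≤ 1})
    (fun h => SchwartzMap.compSubConstCLM ℝ h.1 g - g + ∂_{h.1} g) (fun h => ‖h.1‖ ^ 2)
    (fun k n => by
      obtain ⟨C, h0, h⟩ := exists_seminorm_translate_sub_le g k n
      exact ⟨C, h0, fun i => h i.1 i.2⟩) (fun h => by positivity)
  refine ⟨C, hC0, fun h hh => ?_⟩
  refine le_of_eq_of_le ?_ (hC ⟨h, hh⟩)
  congr 1
  simp only [ContinuousLinearMap.comp_apply, map_add, map_sub, smear]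
  congr 3
  ext y
  simp [add_comm]

/-- The function `g` is translated by `x`, so differentiating in `x` puts a derivative on `g` with a
minus sign. The quadratic Taylor remainder gives differentiability. -/
theorem hasFDerivAt_smear [FiniteDimensional ℝ E] (f : 𝓢(E, ℝ) →L[ℝ] ℝ) (g : 𝓢(E, ℝ)) (x : E) :
    ∃ L : E →L[ℝ] ℝ, (∀ h, L h = -smear f (∂_{h} g) x) ∧ HasFDerivAt (smear f g) L x := by
  let L₀ : E →ₗ[ℝ] ℝ :=
    { toFun h := -smear f (∂_{h} g) x
      map_add' a b := by simp [smear, lineDerivOp_left_add]; ring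
      map_smul' c a := by simp [smear, lineDerivOp_left_smul] }
  refine ⟨LinearMap.toContinuousLinearMap L₀, fun h => rfl, ?_⟩
  obtain ⟨C, hC0, hC⟩ := isBigO_smear_sub f g x
  rw [hasFDerivAt_iff_isLittleO_nhds_zero]
  have h1 : (fun h : E => smear f g (x + h) - smear f g x - LinearMap.toContinuousLinearMap L₀ h)
      =O[𝓝 0] fun h => ‖h‖ ^ 2 := by
    refine Asymptotics.IsBigO.of_bound C ?_
    filter_upwards [Metric.closedBall_mem_nhds (0 : E) one_pos] with h hh
    have := hC h (by simpa using hh)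
    simpa [L₀, sub_neg_eq_add] using this
  exact h1.trans_isLittleO (Asymptotics.isLittleO_norm_pow_id one_lt_two)

theorem fderiv_smear_apply [FiniteDimensional ℝ E] (f : 𝓢(E, ℝ) →L[ℝ] ℝ) (g : 𝓢(E, ℝ)) (x h : E) :
    fderiv ℝ (smear f g) x h = -smear f (∂_{h} g) x := by
  obtain ⟨L, hL, hd⟩ := hasFDerivAt_smear f g x
  rw [hd.fderiv, hL]

theorem contDiff_smear [FiniteDimensional ℝ E] (f : 𝓢(E, ℝ) →L[ℝ] ℝ) (g : 𝓢(E, ℝ)) (n : ℕ) :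
    ContDiff ℝ n (smear f g) := by
  have hd : ∀ g, Differentiable ℝ (smear f g) := fun g x =>
    let ⟨_, _, h⟩ := hasFDerivAt_smear f g x
    h.differentiableAt
  induction n generalizing g with
  | zero => exact contDiff_zero.2 (hd g).continuous
  | succ n ih =>
    have := (contDiff_succ_iff_fderiv_apply (𝕜 := ℝ) (n := (n : WithTop ℕ∞)) (f := smear f g)).2
      ⟨hd g, by simp, fun y => by simpa only [fderiv_smear_apply] using (ih _).neg⟩
    exact_mod_cast this

/-- Multiplication by the dilated cutoff `χ(c ·)`. -/
def cutoffMul {χ : E → ℝ} (hχ : HasCompactSupport χ) (hχ' : ContDiff ℝ ∞ χ) (c : ℝ)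
    (hc : c ≠ 0) (g : 𝓢(E, ℝ)) : 𝓢(E, ℝ) :=
  HasCompactSupport.toSchwartzMap (f := fun x => χ (c • x) * g x)
    ((hχ.comp_smul hc).mul_right)
    ((hχ'.comp (contDiff_id.const_smul c)).mul (g.smooth ⊤))

theorem cutoffMul_apply {χ : E → ℝ} (hχ : HasCompactSupport χ) (hχ' : ContDiff ℝ ∞ χ) (c : ℝ)
    (hc : c ≠ 0) (g : 𝓢(E, ℝ)) (x : E) : cutoffMul hχ hχ' c hc g x = χ (c • x) * g x := rfl

theorem hasCompactSupport_cutoffMul {χ : E → ℝ} (hχ : HasCompactSupport χ) (hχ' : ContDiff ℝ ∞ χ)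
    (c : ℝ) (hc : c ≠ 0) (g : 𝓢(E, ℝ)) : HasCompactSupport (cutoffMul hχ hχ' c hc g) :=
  (hχ.comp_smul hc).mul_right

/-- By the Leibniz rule: the `i`-th derivative of `χ(c ·)` carries a factor `c ^ i`, harmless for
`|c| ≤ 1`. -/
theorem exists_seminorm_cutoffMul_le {χ : E → ℝ} (hχ : HasCompactSupport χ)
    (hχ' : ContDiff ℝ ∞ χ) (g : 𝓢(E, ℝ)) (k n : ℕ) :
    ∃ C, 0 ≤ C ∧ ∀ c (hc : c ≠ 0), |c| ≤ 1 →
      SchwartzMap.seminorm ℝ k n (cutoffMul hχ hχ' c hc g) ≤ C := by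
  have hb : ∀ i : ℕ, ∃ B, 0 ≤ B ∧ ∀ x, ‖iteratedFDeriv ℝ i χ x‖ ≤ B := fun i =>
    exists_one_add_norm_pow_mul_iteratedFDeriv_le (hχ.toSchwartzMap hχ') 0 i |>.imp
      fun B hB => ⟨hB.1, fun x => by
        have := hB.2 x
        rw [pow_zero, one_mul] at this
        exact this⟩
  choose B hB0 hB using hb
  refine ⟨∑ i ∈ Finset.range (n + 1), (n.choose i : ℝ) * B i *
    SchwartzMap.seminorm ℝ k (n - i) g, ?_, fun c hc hc1 => ?_⟩
  · exact Finset.sum_nonneg fun i _ => mul_nonneg (mul_nonneg (by positivity) (hB0 i))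
      (apply_nonneg _ _)
  refine SchwartzMap.seminorm_le_bound ℝ k n _ ?_ fun x => ?_
  · exact Finset.sum_nonneg fun i _ => mul_nonneg (mul_nonneg (by positivity) (hB0 i))
      (apply_nonneg _ _)
  have h1 := norm_iteratedFDeriv_mul_le (𝕜 := ℝ) (f := fun x => χ (c • x)) (g := g) (N := ∞)
    (hχ'.comp (contDiff_id.const_smul c)) (g.smooth ⊤) x (n := n)
    (mod_cast le_top)
  calc _ ≤ ‖x‖ ^ k * ∑ i ∈ Finset.range (n + 1), (n.choose i : ℝ) *
        ‖iteratedFDeriv ℝ i (fun x => χ (c • x)) x‖ * ‖iteratedFDeriv ℝ (n - i) g x‖ := by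
        gcongr; exact h1
    _ = ∑ i ∈ Finset.range (n + 1), (n.choose i : ℝ) *
        ‖iteratedFDeriv ℝ i (fun x => χ (c • x)) x‖ *
          (‖x‖ ^ k * ‖iteratedFDeriv ℝ (n - i) g x‖) := by
        rw [Finset.mul_sum]; exact Finset.sum_congr rfl fun i _ => by ring
    _ ≤ _ := by
        refine Finset.sum_le_sum fun i _ => ?_
        gcongr
        · exact mul_nonneg (by positivity) (hB0 i)
        · rw [iteratedFDeriv_comp_const_smul c (hχ'.of_le (by exact_mod_cast le_top)), norm_smul]
          calc _ ≤ 1 * B i := by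
                gcongr
                · rw [norm_pow]; exact pow_le_one₀ (norm_nonneg _) hc1
                · exact hB i _
            _ = _ := one_mul _
        · exact SchwartzMap.le_seminorm ℝ k (n - i) g x

theorem tendsto_cutoffMul {χ : E → ℝ} (hχ : HasCompactSupport χ) (hχ' : ContDiff ℝ ∞ χ)
    (hχ1 : ∀ x, ‖x‖ ≤ 1 → χ x = 1) (g : 𝓢(E, ℝ)) :
    Tendsto (fun R : ℕ => cutoffMul hχ hχ' ((R : ℝ) + 1)⁻¹ (by positivity) g) atTop (𝓝 g) := by
  rw [(schwartz_withSeminorms ℝ E ℝ).tendsto_nhds]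
  rintro ⟨k, n⟩ ε hε
  obtain ⟨C, hC0, hC⟩ := exists_seminorm_cutoffMul_le hχ hχ' g (k + 1) n
  set C' := C + SchwartzMap.seminorm ℝ (k + 1) n g
  have hC' : 0 ≤ C' := add_nonneg hC0 (apply_nonneg _ _)
  have hlim : Tendsto (fun R : ℕ => C' * ((R : ℝ) + 1)⁻¹) atTop (𝓝 0) := by
    have := (tendsto_one_div_add_atTop_nhds_zero_nat (𝕜 := ℝ)).const_mul C'
    simpa using this
  filter_upwards [hlim.eventually (gt_mem_nhds hε)] with R hR
  refine lt_of_le_of_lt ?_ hR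
  set c : ℝ := ((R : ℝ) + 1)⁻¹ with hc
  have hc0 : 0 < c := by positivity
  have hc1 : c ≤ 1 := inv_le_one_of_one_le₀ (by linarith [(Nat.cast_nonneg R : (0 : ℝ) ≤ R)])
  set f := cutoffMul hχ hχ' c hc0.ne' g - g with hf
  have hfs : SchwartzMap.seminorm ℝ (k + 1) n f ≤ C' :=
    (map_sub_le_add _ _ _).trans (add_le_add (hC c hc0.ne' (by rwa [abs_of_pos hc0])) le_rfl)
  refine SchwartzMap.seminorm_le_bound ℝ k n _ (by positivity) fun x => ?_
  -- Where `c‖x‖ < 1` the cutoff is locally one and the error vanishes with all its derivatives.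
  -- Elsewhere `1 ≤ c‖x‖`, so spending one more power of the weight gains a factor `c`.
  by_cases hx : c * ‖x‖ < 1
  · have : (f : E → ℝ) =ᶠ[𝓝 x] 0 := by
      have : ∀ᶠ z in 𝓝 x, c * ‖z‖ < 1 :=
        (continuous_const.mul continuous_norm).continuousAt.eventually (gt_mem_nhds hx)
      filter_upwards [this] with z hz
      have : χ (c • z) = 1 := hχ1 _ (by rw [norm_smul, Real.norm_of_nonneg hc0.le]; exact hz.le)
      simp [hf, cutoffMul_apply, this]
    rw [(this.iteratedFDeriv ℝ n).eq_of_nhds]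
    simp only [Pi.zero_def, iteratedFDeriv_fun_zero, Pi.zero_apply, norm_zero, mul_zero]
    positivity
  · push Not at hx
    calc ‖x‖ ^ k * ‖iteratedFDeriv ℝ n f x‖
        ≤ (c * ‖x‖) * (‖x‖ ^ k * ‖iteratedFDeriv ℝ n f x‖) :=
          le_mul_of_one_le_left (by positivity) hx
      _ = (‖x‖ ^ (k + 1) * ‖iteratedFDeriv ℝ n f x‖) * c := by ring
      _ ≤ C' * c := by
          gcongr
          exact (SchwartzMap.le_seminorm ℝ (k + 1) n f x).trans hfs

end Schwartz

variable {N : ℕ}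

/-! ### Mean value estimates and the uniform bound. -/

/-- The Laplacian `∑_i ∂_i ∂_i u` of a real function. -/
def lapl (u : Sp N → ℝ) (x : Sp N) : ℝ :=
  ∑ i, fderiv ℝ (fun z => fderiv ℝ u z (EuclideanSpace.single i 1)) x (EuclideanSpace.single i 1)

/-- A radial cutoff `Φ` whose gradient at `y` is `-k(y) y` for a nonnegative kernel `k`. -/
structure IsRadialCutoff (Φ k : Sp N → ℝ) : Prop where
  contDiff : ContDiff ℝ ∞ Φ
  cont : Continuous k
  nonneg : ∀ y, 0 ≤ k y
  zero : ∀ y, 2 ≤ ‖y‖ → Φ y = 0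
  kzero : ∀ y, 2 < ‖y‖ → k y = 0
  fderiv_eq : ∀ y v, fderiv ℝ Φ y v = -(k y * inner ℝ y v)

theorem IsRadialCutoff.hasCompactSupport {Φ k : Sp N → ℝ} (h : IsRadialCutoff Φ k) :
    HasCompactSupport Φ :=
  HasCompactSupport.intro (isCompact_closedBall 0 2) fun y hy => h.zero y (by simpa using
    (not_le.1 (by simpa using hy)).le)

theorem IsRadialCutoff.hasCompactSupport_kernel {Φ k : Sp N → ℝ} (h : IsRadialCutoff Φ k) :
    HasCompactSupport k :=
  HasCompactSupport.intro (isCompact_closedBall 0 2) fun y hy => h.kzero y (by simpa using hy)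

/-- The cutoff is `h(‖y‖²)` with `h` smooth and decreasing from 1 on `t ≤ 1` to 0 on `t ≥ 2`; the
chain rule forces `k = -2h'(‖y‖²)`. -/
theorem exists_isRadialCutoff (hN : 1 ≤ N) :
    ∃ Φ k : Sp N → ℝ, IsRadialCutoff Φ k ∧ (0 < ∫ y, k y) ∧ ∀ y, ‖y‖ ≤ 1 → Φ y = 1 := by
  set h : ℝ → ℝ := fun t => Real.smoothTransition (2 - t) with hh
  have hsm : ContDiff ℝ ∞ h := Real.smoothTransition.contDiff.comp (contDiff_const.sub contDiff_id)
  have hd : Differentiable ℝ h := hsm.differentiable (by simp)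
  have hanti : Antitone h := fun a b hab => Real.smoothTransition.monotone (by linarith)
  have hc' : Continuous (deriv h) := hsm.continuous_deriv (by simp)
  have h4 : ∀ y : Sp N, 2 < ‖y‖ → 2 < ‖y‖ ^ 2 := fun y hy => by nlinarith
  refine ⟨fun y => h (‖y‖ ^ 2), fun y => -(2 * deriv h (‖y‖ ^ 2)), ⟨?_, ?_, ?_, ?_, ?_, ?_⟩, ?_, ?_⟩
  · exact hsm.comp (contDiff_norm_sq ℝ)
  · fun_prop
  · intro y
    have := hanti.deriv_nonpos (x := ‖y‖ ^ 2)
    linarith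
  · intro y hy
    exact Real.smoothTransition.zero_of_nonpos (by nlinarith)
  · intro y hy
    have : h =ᶠ[𝓝 (‖y‖ ^ 2)] fun _ => 0 := by
      filter_upwards [lt_mem_nhds (h4 y hy)] with t ht
      exact Real.smoothTransition.zero_of_nonpos (by linarith)
    simp [this.deriv_eq]
  · intro y v
    have h1 : HasFDerivAt (fun y : Sp N => ‖y‖ ^ 2) (2 • innerSL ℝ y) y :=
      (hasStrictFDerivAt_norm_sq y).hasFDerivAt
    have h2 := (hd (‖y‖ ^ 2)).hasDerivAt.comp_hasFDerivAt y h1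
    rw [show (fun y : Sp N => h (‖y‖ ^ 2)) = h ∘ fun y => ‖y‖ ^ 2 from rfl, h2.fderiv]
    simp
    ring
  -- Since `h` drops from 1 to 0 on `[0,2]`, some `t` there has `h'(t) = -1/2`, so the kernel is
  -- positive at distance `√t` from the origin.
  · obtain ⟨t, ht, hts⟩ := exists_deriv_eq_slope h (a := 0) (b := 2) (by norm_num)
      hd.continuous.continuousOn hd.differentiableOn
    have h0 : h 0 = 1 := Real.smoothTransition.one_of_one_le (by norm_num)
    have h2 : h 2 = 0 := Real.smoothTransition.zero_of_nonpos (by norm_num)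
    rw [h0, h2] at hts
    refine Continuous.integral_pos_of_hasCompactSupport_nonneg_nonzero
      (x := EuclideanSpace.single (⟨0, hN⟩ : Fin N) (√t)) (by fun_prop) ?_ ?_ ?_
    · refine HasCompactSupport.intro (isCompact_closedBall 0 2) fun y hy => ?_
      have hy : 2 < ‖y‖ := by simpa using hy
      have : h =ᶠ[𝓝 (‖y‖ ^ 2)] fun _ => 0 := by
        filter_upwards [lt_mem_nhds (h4 y hy)] with t ht
        exact Real.smoothTransition.zero_of_nonpos (by linarith)
      simp [this.deriv_eq]
    · intro y
      have := hanti.deriv_nonpos (x := ‖y‖ ^ 2)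
      simp only [Pi.zero_apply]
      linarith
    · simp only [PiLp.norm_single, Real.norm_eq_abs, sq_abs, Real.sq_sqrt ht.1.le, hts]
      norm_num
  · intro y hy
    exact Real.smoothTransition.one_of_one_le (by nlinarith [norm_nonneg y])

theorem inner_eq_sum_single (y : Sp N) (L : Sp N →L[ℝ] ℝ) :
    L y = ∑ i, L (EuclideanSpace.single i 1) * inner ℝ y (EuclideanSpace.single i 1) := by
  conv_lhs => rw [← (EuclideanSpace.basisFun (Fin N) ℝ).sum_repr y]
  simp [EuclideanSpace.inner_single_right, mul_comm]

/-- Differentiation under the integral produces `∇u(x + ry) · y k(y) = -∇u(x + ry) · ∇Φ(y)`.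
Integrating by parts moves the derivative back to `u`, at the cost of a factor `r`. -/
theorem IsRadialCutoff.hasDerivAt_mean {Φ k : Sp N → ℝ} (h : IsRadialCutoff Φ k)
    {u : Sp N → ℝ} (hu : ContDiff ℝ 2 u) (x : Sp N) (r : ℝ) :
    HasDerivAt (fun r : ℝ => ∫ y, u (x + r • y) * k y)
      (r * ∫ y, lapl u (x + r • y) * Φ y) r := by
  have hkc := h.hasCompactSupport_kernel
  have hud : Differentiable ℝ u := hu.differentiable (by simp)
  have hu' : Continuous (fderiv ℝ u) := hu.continuous_fderiv (by simp)
  have hdu : ∀ i, ContDiff ℝ 1 fun z => fderiv ℝ u z (EuclideanSpace.single i 1) := fun i =>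
    (hu.fderiv_right (m := 1) (by norm_num)).clm_apply contDiff_const
  obtain ⟨C, hC⟩ : ∃ C, ∀ p ∈ (Metric.closedBall r 1) ×ˢ (Metric.closedBall (0 : Sp N) 2),
      ‖fderiv ℝ u (x + p.1 • p.2) p.2‖ ≤ C :=
    ((isCompact_closedBall r 1).prod (isCompact_closedBall (0 : Sp N) 2)).exists_bound_of_continuousOn
      (by fun_prop)
  have key := (hasDerivAt_integral_of_dominated_loc_of_deriv_le (μ := volume)
    (F := fun (r : ℝ) (y : Sp N) => u (x + r • y) * k y)
    (F' := fun (r : ℝ) (y : Sp N) => fderiv ℝ u (x + r • y) y * k y)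
    (bound := fun y => C * k y) (x₀ := r) (s := Metric.closedBall r 1)
    (Metric.closedBall_mem_nhds _ one_pos) ?_ ?_ ?_ ?_ ?_ ?_).2
  · refine key.congr_deriv ?_
    have e1 : ∀ y, fderiv ℝ u (x + r • y) y * k y =
        ∑ i, -(fderiv ℝ u (x + r • y) (EuclideanSpace.single i 1) *
          fderiv ℝ Φ y (EuclideanSpace.single i 1)) := by
      intro y
      rw [inner_eq_sum_single y (fderiv ℝ u (x + r • y)), Finset.sum_mul]
      refine Finset.sum_congr rfl fun i _ => ?_
      rw [h.fderiv_eq]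
      ring
    have hΦ' : ∀ i, Continuous fun y => fderiv ℝ Φ y (EuclideanSpace.single i 1) := fun i =>
      (h.contDiff.continuous_fderiv (by simp)).clm_apply continuous_const
    have hfd : ∀ (i : Fin N) y, fderiv ℝ (fun y => fderiv ℝ u (x + r • y)
        (EuclideanSpace.single i 1)) y (EuclideanSpace.single i 1) =
        r * fderiv ℝ (fun z => fderiv ℝ u z (EuclideanSpace.single i 1)) (x + r • y)
          (EuclideanSpace.single i 1) := by
      intro i y
      have h1 : HasFDerivAt (fun y : Sp N => x + r • y) (r • ContinuousLinearMap.id ℝ (Sp N)) y :=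
        ((hasFDerivAt_id y).const_smul r).const_add x
      have h2 := (((hdu i).differentiable (by simp)) (x + r • y)).hasFDerivAt.comp y h1
      have h3 := h2.fderiv
      rw [show (fun y => fderiv ℝ u (x + r • y) (EuclideanSpace.single i 1)) =
        (fun z => fderiv ℝ u z (EuclideanSpace.single i 1)) ∘ fun y => x + r • y from rfl, h3]
      simp
    have hcont1 : ∀ i, Continuous fun y : Sp N =>
        fderiv ℝ u (x + r • y) (EuclideanSpace.single i 1) := fun i => by fun_prop
    have hcont2 : ∀ i, Continuous fun y : Sp N =>
        fderiv ℝ (fun z => fderiv ℝ u z (EuclideanSpace.single i 1)) (x + r • y)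
          (EuclideanSpace.single i 1) := fun i =>
      (((hdu i).continuous_fderiv (by simp)).comp (by fun_prop)).clm_apply continuous_const
    have hΦs := h.hasCompactSupport
    have hΦc := h.contDiff.continuous
    have hi2 : ∀ i, Integrable fun y : Sp N => fderiv ℝ (fun z => fderiv ℝ u z
        (EuclideanSpace.single i 1)) (x + r • y) (EuclideanSpace.single i 1) * Φ y := fun i =>
      ((hcont2 i).mul hΦc).integrable_of_hasCompactSupport hΦs.mul_left
    have hi1 : ∀ i, Integrable fun y : Sp N => fderiv ℝ u (x + r • y) (EuclideanSpace.single i 1) *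
          fderiv ℝ Φ y (EuclideanSpace.single i 1) := fun i =>
      ((hcont1 i).mul (hΦ' i)).integrable_of_hasCompactSupport
        (HasCompactSupport.mul_left (hΦs.fderiv_apply ℝ _))
    simp_rw [e1]
    rw [integral_finsetSum _ fun i _ => by simpa using (hi1 i).neg]
    simp_rw [lapl, Finset.sum_mul]
    rw [integral_finsetSum _ fun i _ => hi2 i, Finset.mul_sum]
    refine Finset.sum_congr rfl fun i _ => ?_
    rw [integral_neg, integral_mul_fderiv_eq_neg_fderiv_mul_of_integrable, neg_neg,
      ← integral_const_mul]
    · refine integral_congr_ae (.of_forall fun y => ?_)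
      simp only [hfd]
      ring
    · simp only [hfd]
      simpa only [mul_assoc] using (hi2 i).const_mul r
    · exact hi1 i
    · exact ((hcont1 i).mul hΦc).integrable_of_hasCompactSupport hΦs.mul_left
    · intro y _
      exact (((hdu i).differentiable (by simp)) _).comp y (by fun_prop)
    · intro y _
      exact h.contDiff.differentiable (by simp) y
  · exact .of_forall fun r => (by fun_prop : Continuous _).aestronglyMeasurable.mul
      h.cont.aestronglyMeasurable
  · exact ((by fun_prop : Continuous fun y => u (x + r • y)).mul h.cont).integrable_of_hasCompactSupport
      hkc.mul_left
  · exact ((by fun_prop : Continuous fun y => fderiv ℝ u (x + r • y) y).mul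
      h.cont).aestronglyMeasurable
  · refine .of_forall fun y s hs => ?_
    rw [norm_mul, Real.norm_of_nonneg (h.nonneg y)]
    by_cases hy : ‖y‖ ≤ 2
    · exact mul_le_mul_of_nonneg_right (hC (s, y) ⟨hs, by simpa using hy⟩) (h.nonneg y)
    · simp [h.kzero y (not_le.1 hy)]
  · exact (h.cont.integrable_of_hasCompactSupport hkc).const_mul C
  · refine .of_forall fun y s _ => ?_
    have h1 : HasDerivAt (fun s : ℝ => x + s • y) y s := by
      simpa using ((hasDerivAt_id s).smul_const y).const_add x
    exact ((hud (x + s • y)).hasFDerivAt.comp_hasDerivAt s h1).mul_const (k y)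

/-- A quantitative mean value inequality for functions with bounded Laplacian. -/
theorem exists_mean_value_bound (hN : 1 ≤ N) : ∃ C : ℝ, 0 < C ∧ ∀ u : Sp N → ℝ, ContDiff ℝ 2 u →
    ∀ D, (∀ x, |lapl u x| ≤ D) → ∀ x R, 0 < R →
      |u x| ≤ C * (∫ y in Metric.closedBall (0 : Sp N) 2, |u (x + R • y)|) + C * (D * R ^ 2) := by
  obtain ⟨Φ, k, h, hI, -⟩ := exists_isRadialCutoff hN
  set I := ∫ y, k y
  obtain ⟨K, hK⟩ := h.cont.bounded_above_of_compact_support h.hasCompactSupport_kernel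
  have hK0 : 0 ≤ K := (norm_nonneg _).trans (hK 0)
  set J := ∫ y, |Φ y|
  have hJ0 : 0 ≤ J := integral_nonneg fun _ => abs_nonneg _
  have hΦi : Integrable Φ := h.contDiff.continuous.integrable_of_hasCompactSupport h.hasCompactSupport
  -- `K` bounds the kernel and `J` is the `L¹` norm of `Φ`; the extra 1 makes the constant positive.
  refine ⟨(K + J + 1) / I, by positivity, fun u hu D hD x R hR => ?_⟩
  have hD0 : 0 ≤ D := (abs_nonneg _).trans (hD 0)
  have huc : Continuous u := hu.continuous
  set A : ℝ → ℝ := fun r => ∫ y, u (x + r • y) * k y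
  have h1 : ‖A R - A 0‖ ≤ R * (D * J) * (R - 0) := by
    refine norm_image_sub_le_of_norm_deriv_le_segment' (a := 0) (b := R)
      (fun r _ => (h.hasDerivAt_mean hu x r).hasDerivWithinAt) (fun r hr => ?_) R
      ⟨hR.le, le_rfl⟩
    rw [norm_mul, Real.norm_of_nonneg hr.1]
    refine mul_le_mul hr.2.le ?_ (norm_nonneg _) hR.le
    calc _ ≤ ∫ y, D * |Φ y| := by
          refine norm_integral_le_of_norm_le (hΦi.abs.const_mul D) (.of_forall fun y => ?_)
          rw [norm_mul, Real.norm_eq_abs, Real.norm_eq_abs]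
          gcongr
          exact hD _
      _ = D * J := integral_const_mul _ _
  have h2 : A 0 = u x * I := by
    simp only [A, zero_smul, add_zero]
    exact integral_const_mul _ _
  set S := ∫ y in Metric.closedBall (0 : Sp N) 2, |u (x + R • y)|
  have hS0 : 0 ≤ S := integral_nonneg fun _ => abs_nonneg _
  have hSi : IntegrableOn (fun y => |u (x + R • y)|) (Metric.closedBall (0 : Sp N) 2) :=
    (by fun_prop : Continuous fun y => |u (x + R • y)|).continuousOn.integrableOn_compact
      (isCompact_closedBall _ _)
  have h3 : |A R| ≤ K * S := by
    have e : A R = ∫ y in Metric.closedBall (0 : Sp N) 2, u (x + R • y) * k y := by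
      refine (setIntegral_eq_integral_of_forall_compl_eq_zero fun y hy => ?_).symm
      rw [h.kzero y (by simpa using hy), mul_zero]
    rw [e, ← Real.norm_eq_abs, ← integral_const_mul]
    refine norm_integral_le_of_norm_le (hSi.const_mul K) (.of_forall fun y => ?_)
    rw [norm_mul, Real.norm_eq_abs, mul_comm]
    gcongr
    exact hK y
  have h4 : |u x| * I ≤ K * S + R * (D * J) * R := by
    rw [← abs_of_pos hI, ← abs_mul, ← h2]
    rw [Real.norm_eq_abs, sub_zero] at h1
    have := abs_sub_abs_le_abs_sub (A 0) (A R)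
    rw [abs_sub_comm] at this
    linarith
  rw [← mul_add, div_mul_eq_mul_div, le_div_iff₀ hI]
  refine h4.trans ?_
  have : 0 ≤ D * R ^ 2 := by positivity
  nlinarith [mul_nonneg hJ0 hS0, mul_nonneg hK0 this]

theorem lintegral_comp_smul_Sp (f : Sp N → ℝ≥0∞) {R : ℝ} (hR : 0 < R) :
    ∫⁻ y, f (R • y) = ENNReal.ofReal ((R ^ N)⁻¹) * ∫⁻ y, f y := by
  have h1 : MeasurableEmbedding fun y : Sp N => R • y :=
    (Homeomorph.smulOfNeZero R hR.ne').measurableEmbedding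
  rw [← h1.lintegral_map, Measure.map_addHaar_smul _ hR.ne', lintegral_smul_measure]
  simp [abs_of_pos hR]

/-- If `∫ |u|^q ≤ M`, `|Δu| ≤ D` and `u` has polynomial growth, then `u` is bounded in terms of
`D` and `M` only. -/
theorem exists_uniform_bound (hN : 1 ≤ N) (D M q : ℝ) (hD : 0 ≤ D) (hM : 0 ≤ M) (hq : 0 < q) :
    ∃ B, 0 ≤ B ∧ ∀ u : Sp N → ℝ, ContDiff ℝ 2 u → (∀ x, |lapl u x| ≤ D) →
      (∫⁻ x, ENNReal.ofReal |u x| ^ q ≤ ENNReal.ofReal M) →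
      (∃ (A : ℝ) (m : ℕ), 0 ≤ A ∧ ∀ x, |u x| ≤ A * (1 + ‖x‖) ^ m) → ∀ x, |u x| ≤ B := by
  obtain ⟨C, hC, hmv⟩ := exists_mean_value_bound hN
  -- The radius is chosen so that the coefficient `C M R^{-N}` of the local supremum is at most one
  -- half.
  set R : ℝ := max 1 (2 * C * M)
  have hR1 : 1 ≤ R := le_max_left _ _
  have hR0 : 0 < R := by linarith
  have hRN : C * (M * (R ^ N)⁻¹) ≤ 1 / 2 := by
    have h1 : R ≤ R ^ N := le_self_pow₀ hR1 (by lia)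
    have h2 : 2 * C * M ≤ R := le_max_right _ _
    rw [← mul_assoc, ← div_eq_mul_inv, div_le_iff₀ (by positivity)]
    linarith
  set V := volume.real (Metric.closedBall (0 : Sp N) 2)
  have hV : 0 ≤ V := measureReal_nonneg
  set C₁ := C * V + C * (D * R ^ 2)
  have hC₁ : 0 ≤ C₁ := by positivity
  refine ⟨2 * C₁, by positivity, fun u hu hlap hint ⟨A, m, hA, hgr⟩ => ?_⟩
  have huc : Continuous u := hu.continuous
  -- One absorption step: the bound `S` on a larger ball returns at the centre with factor one half,
  -- plus a constant depending only on the data.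
  have step : ∀ x S, 0 ≤ S → (∀ z, ‖z‖ ≤ ‖x‖ + 2 * R → |u z| ≤ S) → |u x| ≤ C₁ + S / 2 := by
    intro x S hS hzS
    have h1 := hmv u hu D hlap x R hR0
    have hqm : Measurable fun y => |u (x + R • y)| ^ q :=
      (by fun_prop : Continuous fun y => |u (x + R • y)|).measurable.pow_const q
    have hlin : ∫⁻ y, ENNReal.ofReal (|u (x + R • y)| ^ q) ≤ ENNReal.ofReal (M * (R ^ N)⁻¹) := by
      have e1 := lintegral_comp_smul_Sp (fun y => ENNReal.ofReal |u (x + y)| ^ q) hR0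
      have e2 := lintegral_add_left_eq_self (μ := (volume : Measure (Sp N)))
        (fun y => ENNReal.ofReal |u y| ^ q) x
      rw [e2] at e1
      simp_rw [← ENNReal.ofReal_rpow_of_nonneg (abs_nonneg _) hq.le]
      rw [e1, mul_comm, ENNReal.ofReal_mul hM]
      gcongr
    have hint' : Integrable fun y => |u (x + R • y)| ^ q := by
      refine ⟨hqm.aestronglyMeasurable, ?_⟩
      rw [hasFiniteIntegral_iff_ofReal (.of_forall fun y => by positivity)]
      exact hlin.trans_lt ENNReal.ofReal_lt_top
    have hle : ∫ y, |u (x + R • y)| ^ q ≤ M * (R ^ N)⁻¹ := by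
      rw [integral_eq_lintegral_of_nonneg_ae (.of_forall fun y => by positivity)
        hqm.aestronglyMeasurable]
      exact ENNReal.toReal_le_of_le_ofReal (by positivity) hlin
    -- If `|u| > 1` then `|u|^q ≥ 1`, so `|u| ≤ S ≤ S|u|^q`. Hence the integral of `|u|^q` controls
    -- the local mean of `|u|`.
    have hcomp : ∀ y ∈ Metric.closedBall (0 : Sp N) 2,
        |u (x + R • y)| ≤ 1 + S * |u (x + R • y)| ^ q := by
      intro y hy
      rcases le_or_gt |u (x + R • y)| 1 with h | h
      · have : 0 ≤ S * |u (x + R • y)| ^ q := by positivity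
        linarith
      · have h2 : |u (x + R • y)| ≤ S := by
          refine hzS _ ((norm_add_le _ _).trans ?_)
          rw [norm_smul, Real.norm_of_nonneg hR0.le, mul_comm]
          gcongr
          simpa using hy
        have h3 : 1 ≤ |u (x + R • y)| ^ q := Real.one_le_rpow h.le hq.le
        nlinarith
    have hconst : IntegrableOn (fun _ : Sp N => (1 : ℝ)) (Metric.closedBall (0 : Sp N) 2) :=
      continuousOn_const.integrableOn_compact (isCompact_closedBall _ _)
    have hs : ∫ y in Metric.closedBall (0 : Sp N) 2, |u (x + R • y)| ≤
        V + S * (M * (R ^ N)⁻¹) := by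
      calc _ ≤ ∫ y in Metric.closedBall (0 : Sp N) 2, (1 + S * |u (x + R • y)| ^ q) := by
            refine setIntegral_mono_on ?_ ?_ measurableSet_closedBall hcomp
            · exact (by fun_prop : Continuous fun y =>
                |u (x + R • y)|).continuousOn.integrableOn_compact (isCompact_closedBall _ _)
            · exact hconst.add (hint'.integrableOn.const_mul S)
        _ = V + S * ∫ y in Metric.closedBall (0 : Sp N) 2, |u (x + R • y)| ^ q := by
            rw [integral_add hconst (hint'.integrableOn.const_mul S), integral_const_mul]
            simp [V, Measure.real]
        _ ≤ V + S * ∫ y, |u (x + R • y)| ^ q := by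
            exact add_le_add le_rfl (mul_le_mul_of_nonneg_left
              (setIntegral_le_integral hint' (.of_forall fun y => by positivity)) hS)
        _ ≤ _ := by gcongr
    calc |u x| ≤ C * (V + S * (M * (R ^ N)⁻¹)) + C * (D * R ^ 2) := by
          refine h1.trans ?_
          gcongr
      _ = C₁ + S * (C * (M * (R ^ N)⁻¹)) := by simp only [C₁]; ring
      _ ≤ C₁ + S * (1 / 2) := by gcongr
      _ = _ := by ring
  -- Each step enlarges the radius by `2R` and halves the excess, so the polynomial growth is beaten
  -- by `2^{-n}` and drops out of the limit.
  have iter : ∀ n : ℕ, ∀ x, |u x| ≤ 2 * C₁ + (1 / 2) ^ n * (A * (1 + ‖x‖ + 2 * R * n) ^ m) := by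
    intro n
    induction n with
    | zero =>
      intro x
      refine (hgr x).trans ?_
      simp
      linarith
    | succ n ih =>
      intro x
      refine (step x (2 * C₁ + (1 / 2) ^ n * (A * (1 + (‖x‖ + 2 * R) + 2 * R * n) ^ m))
        (by positivity) fun z hz => (ih z).trans ?_).trans ?_
      · gcongr
      · push_cast
        rw [show 1 + (‖x‖ + 2 * R) + 2 * R * n = 1 + ‖x‖ + 2 * R * (n + 1) by ring, pow_succ]
        apply le_of_eq
        ring
  intro x
  have hlim : Tendsto (fun n : ℕ => 2 * C₁ + A * (1 + ‖x‖ + 2 * R) ^ m * ((n : ℝ) ^ m / 2 ^ n))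
      atTop (𝓝 (2 * C₁ + A * (1 + ‖x‖ + 2 * R) ^ m * 0)) :=
    ((tendsto_pow_const_div_const_pow_of_one_lt m one_lt_two).const_mul _).const_add _
  rw [mul_zero, add_zero] at hlim
  refine ge_of_tendsto hlim ?_
  filter_upwards [eventually_ge_atTop 1] with n hn
  refine (iter n x).trans ?_
  have hn' : (1 : ℝ) ≤ n := by exact_mod_cast hn
  have : 1 + ‖x‖ + 2 * R * n ≤ (1 + ‖x‖ + 2 * R) * n := by
    nlinarith [norm_nonneg x]
  calc _ ≤ 2 * C₁ + (1 / 2) ^ n * (A * ((1 + ‖x‖ + 2 * R) * n) ^ m) := by gcongr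
    _ = _ := by rw [mul_pow, one_div, inv_pow]; ring

/-! ### Hessians, dilations and integrable tensors. -/

/-- The second derivative `∂_i ∂_j` on Schwartz functions. -/
def hess (i j : Fin N) : 𝓢(Sp N, ℝ) →L[ℝ] 𝓢(Sp N, ℝ) :=
  (lineDerivOpCLM ℝ 𝓢(Sp N, ℝ) (EuclideanSpace.single i (1 : ℝ))).comp
    (lineDerivOpCLM ℝ 𝓢(Sp N, ℝ) (EuclideanSpace.single j (1 : ℝ)))

theorem hess_eq (i j : Fin N) (ψ : 𝓢(Sp N, ℝ)) :
    hess i j ψ = ∂_{EuclideanSpace.single i (1 : ℝ)} (∂_{EuclideanSpace.single j (1 : ℝ)} ψ) := rfl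

theorem hess_apply (i j : Fin N) (ψ : 𝓢(Sp N, ℝ)) (x : Sp N) :
    hess i j ψ x = fderiv ℝ (fun y => fderiv ℝ ψ y (EuclideanSpace.single j 1)) x
      (EuclideanSpace.single i 1) := rfl

theorem hess_comm (i j : Fin N) (ψ : 𝓢(Sp N, ℝ)) : hess i j ψ = hess j i ψ :=
  lineDerivOp_comm _ _ _

theorem laplacian_eq_sum_hess (ψ : 𝓢(Sp N, ℝ)) : Δ ψ = ∑ i, hess i i ψ := by
  rw [SchwartzMap.laplacian_eq_sum (EuclideanSpace.basisFun (Fin N) ℝ)]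
  simp [hess_eq]

/-- The dilation `x ↦ ψ(c x)`. -/
def dilate (c : ℝ) (hc : c ≠ 0) : 𝓢(Sp N, ℝ) →L[ℝ] 𝓢(Sp N, ℝ) :=
  SchwartzMap.compCLMOfContinuousLinearEquiv ℝ (ContinuousLinearEquiv.smulLeft (Units.mk0 c hc))

theorem dilate_apply (c : ℝ) (hc : c ≠ 0) (ψ : 𝓢(Sp N, ℝ)) (x : Sp N) :
    dilate c hc ψ x = ψ (c • x) := rfl

theorem hess_dilate (i j : Fin N) (c : ℝ) (hc : c ≠ 0) (ψ : 𝓢(Sp N, ℝ)) :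
    hess i j (dilate c hc ψ) = c ^ 2 • dilate c hc (hess i j ψ) := by
  have h : ∀ (m : Sp N) (φ : 𝓢(Sp N, ℝ)), ∂_{m} (dilate c hc φ) = c • dilate c hc (∂_{m} φ) := by
    intro m φ
    rw [dilate, SchwartzMap.lineDerivOp_compCLMOfContinuousLinearEquiv]
    have : (ContinuousLinearEquiv.smulLeft (Units.mk0 c hc) : Sp N ≃L[ℝ] Sp N) m = c • m := rfl
    rw [this, lineDerivOp_left_smul, map_smul]
  simp only [hess_eq]
  rw [h, lineDerivOp_smul, h, smul_smul, sq]

theorem hess_translate (i j : Fin N) (a : Sp N) (ψ : 𝓢(Sp N, ℝ)) :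
    hess i j (SchwartzMap.compSubConstCLM ℝ a ψ) = SchwartzMap.compSubConstCLM ℝ a (hess i j ψ) := by
  have h : ∀ (m : Sp N) (φ : 𝓢(Sp N, ℝ)), ∂_{m} (SchwartzMap.compSubConstCLM ℝ a φ) =
      SchwartzMap.compSubConstCLM ℝ a (∂_{m} φ) := by
    intro m φ
    ext x
    rw [SchwartzMap.lineDerivOp_apply_eq_fderiv, SchwartzMap.compSubConstCLM_apply,
      SchwartzMap.lineDerivOp_apply_eq_fderiv, ← fderiv_comp_sub]
    rfl
  simp only [hess_eq, h]

theorem laplacian_translate (a : Sp N) (ψ : 𝓢(Sp N, ℝ)) :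
    Δ (SchwartzMap.compSubConstCLM ℝ a ψ) = SchwartzMap.compSubConstCLM ℝ a (Δ ψ) := by
  simp only [laplacian_eq_sum_hess, hess_translate, map_sum]

theorem kernelS_eq (η : 𝓢(Sp N, ℝ)) (s : ℝ) (hs : 0 < s) (x : Sp N) :
    kernelS η s hs x = (s ^ N)⁻¹ • SchwartzMap.compSubConstCLM ℝ x
      (dilate (-s⁻¹) (neg_ne_zero.mpr (inv_ne_zero hs.ne')) η) := rfl

theorem abs_le_seminorm (ψ : 𝓢(Sp N, ℝ)) (x : Sp N) :
    |ψ x| ≤ SchwartzMap.seminorm ℝ 0 0 ψ := SchwartzMap.norm_le_seminorm ℝ ψ x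

theorem integrable_mul_schwartz {F : Sp N → ℝ} (hF : Integrable F) (ψ : 𝓢(Sp N, ℝ)) :
    Integrable fun x => F x * ψ x :=
  hF.mul_bdd (c := SchwartzMap.seminorm ℝ 0 0 ψ) ψ.continuous.aestronglyMeasurable
    (.of_forall fun x => abs_le_seminorm ψ x)

theorem abs_integral_mul_le {F : Sp N → ℝ} (hF : Integrable F) {g : Sp N → ℝ} {B : ℝ}
    (hg : ∀ x, |g x| ≤ B) : |∫ x, F x * g x| ≤ (∫ x, |F x|) * B := by
  rw [← integral_mul_const, ← Real.norm_eq_abs]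
  refine norm_integral_le_of_norm_le (hF.abs.mul_const B) (.of_forall fun x => ?_)
  rw [norm_mul, Real.norm_eq_abs, Real.norm_eq_abs]
  gcongr
  exact hg x

/-- The tempered distribution given by an integrable function. -/
def ofIntegrable (F : Sp N → ℝ) (hF : Integrable F) : Distr N :=
  SchwartzMap.mkCLMtoNormedSpace (𝕜 := ℝ) (𝕜' := ℝ) (σ := RingHom.id ℝ)
    (fun ψ => ∫ x, F x * ψ x)
    (fun ψ φ => by
      rw [← integral_add (integrable_mul_schwartz hF ψ) (integrable_mul_schwartz hF φ)]
      simp [mul_add])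
    (fun c ψ => by
      rw [RingHom.id_apply, smul_eq_mul, ← integral_const_mul]
      simp [mul_left_comm])
    ⟨{(0, 0)}, ∫ x, |F x|, integral_nonneg fun _ => abs_nonneg _, fun ψ => by
      simpa using abs_integral_mul_le hF (abs_le_seminorm ψ)⟩

theorem ofIntegrable_apply (F : Sp N → ℝ) (hF : Integrable F) (ψ : 𝓢(Sp N, ℝ)) :
    ofIntegrable F hF ψ = ∫ x, F x * ψ x := rfl

/-- By dominated convergence, a test function spread out at large scale sees `F` only through its
total mass. -/
theorem tendsto_integral_mul_comp_smul {F : Sp N → ℝ} (hF : Integrable F) (g : 𝓢(Sp N, ℝ))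
    {c : ℕ → ℝ} (hc : Tendsto c atTop (𝓝 0)) (z : Sp N) :
    Tendsto (fun n => ∫ y, F y * g (z + c n • y)) atTop (𝓝 ((∫ y, F y) * g z)) := by
  rw [← integral_mul_const]
  have hg := g.continuous
  refine tendsto_integral_of_dominated_convergence
    (fun y => |F y| * SchwartzMap.seminorm ℝ 0 0 g) (fun n => ?_) (hF.abs.mul_const _)
    (fun n => .of_forall fun y => ?_) (.of_forall fun y => ?_)
  · exact hF.aestronglyMeasurable.mul (by fun_prop : Continuous _).aestronglyMeasurable
  · rw [norm_mul, Real.norm_eq_abs, Real.norm_eq_abs]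
    gcongr
    exact abs_le_seminorm g _
  · refine Tendsto.const_mul _ ?_
    have : Tendsto (fun n => z + c n • y) atTop (𝓝 (z + (0 : ℝ) • y)) :=
      (hc.smul_const y).const_add z
    rw [zero_smul, add_zero] at this
    exact (hg.tendsto z).comp this

/-- A compactly supported Schwartz function equal to `x_k²` near the origin. -/
theorem exists_localSquare (hN : 1 ≤ N) (k : Fin N) : ∃ Ψ : 𝓢(Sp N, ℝ), HasCompactSupport Ψ ∧
    ∀ i j, hess i j Ψ 0 = if i = k ∧ j = k then 2 else 0 := by
  obtain ⟨χ, _, h, -, h1⟩ := exists_isRadialCutoff hN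
  set P : Sp N →L[ℝ] ℝ := EuclideanSpace.proj k
  have hs : HasCompactSupport fun x : Sp N => χ x * (P x) ^ 2 := h.hasCompactSupport.mul_right
  refine ⟨hs.toSchwartzMap (h.contDiff.mul (P.contDiff.pow 2)), hs, fun i j => ?_⟩
  rw [hess_apply]
  have e0 : (fun x : Sp N => χ x * (P x) ^ 2) =ᶠ[𝓝 0] fun x => (P x) ^ 2 := by
    filter_upwards [Metric.ball_mem_nhds (0 : Sp N) one_pos] with x hx
    rw [h1 x (by simpa using (mem_ball_zero_iff.1 hx).le), one_mul]
  have e1 : (fun y => fderiv ℝ (fun x : Sp N => χ x * (P x) ^ 2) y (EuclideanSpace.single j 1))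
      =ᶠ[𝓝 0] fun y => 2 * P y * P (EuclideanSpace.single j 1) := by
    filter_upwards [e0.fderiv (𝕜 := ℝ)] with y hy
    rw [hy, (P.hasFDerivAt.pow 2).fderiv]
    simp
  change fderiv ℝ (fun y => fderiv ℝ (fun x : Sp N => χ x * (P x) ^ 2) y
    (EuclideanSpace.single j 1)) 0 (EuclideanSpace.single i 1) = _
  have hP : ∀ l : Fin N, P (EuclideanSpace.single l 1) = if l = k then 1 else 0 := fun l => by
    by_cases hl : l = k
    · simp [P, hl]
    · simp [P, hl, Ne.symm hl]
  rw [e1.fderiv_eq, ((P.hasFDerivAt.const_mul 2).mul_const (P (EuclideanSpace.single j 1))).fderiv,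
    smul_apply, smul_apply, hP, hP]
  by_cases hi : i = k <;> by_cases hj : j = k <;> simp [hi, hj]

/-- `∑_{ij} ∫ F_ij ∂_i ∂_j ψ`. -/
def hessPair (F : Fin N → Fin N → Sp N → ℝ) (hF : ∀ i j, Integrable (F i j)) : Distr N :=
  ∑ i, ∑ j, (ofIntegrable (F i j) (hF i j)).comp (hess i j)

theorem hessPair_apply (F : Fin N → Fin N → Sp N → ℝ) (hF : ∀ i j, Integrable (F i j))
    (ψ : 𝓢(Sp N, ℝ)) : hessPair F hF ψ = ∑ i, ∑ j, ∫ x, F i j x * hess i j ψ x := by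
  simp [hessPair, ofIntegrable_apply]

theorem lapl_comp_smul {u : Sp N → ℝ} (hu : ContDiff ℝ 2 u) (c : ℝ) (x : Sp N) :
    lapl (fun x => u (c • x)) x = c ^ 2 * lapl u (c • x) := by
  have hd : ∀ {w : Sp N → ℝ}, Differentiable ℝ w → ∀ y v,
      fderiv ℝ (fun x => w (c • x)) y v = c * fderiv ℝ w (c • y) v := by
    intro w hw y v
    have h1 : HasFDerivAt (fun y : Sp N => c • y) (c • ContinuousLinearMap.id ℝ (Sp N)) y :=
      (hasFDerivAt_id y).const_smul c
    have h2 := ((hw (c • y)).hasFDerivAt.comp y h1).fderiv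
    rw [show (fun x => w (c • x)) = w ∘ fun x => c • x from rfl, h2]
    simp
  have hu1 : Differentiable ℝ u := hu.differentiable (by simp)
  have hu2 : ∀ v, Differentiable ℝ fun z => fderiv ℝ u z v := fun v =>
    ((hu.fderiv_right (m := 1) (by norm_num)).clm_apply contDiff_const).differentiable (by simp)
  unfold lapl
  rw [Finset.mul_sum]
  refine Finset.sum_congr rfl fun i _ => ?_
  simp_rw [hd hu1]
  have hdiff : DifferentiableAt ℝ (fun z => fderiv ℝ u (c • z) (EuclideanSpace.single i 1)) x :=
    (hu2 _).comp (by fun_prop : Differentiable ℝ fun x : Sp N => c • x) x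
  rw [fderiv_const_mul hdiff, smul_apply, smul_eq_mul, hd (hu2 _)]
  ring

theorem lapl_smear (f : Distr N) (g : 𝓢(Sp N, ℝ)) (x : Sp N) :
    lapl (smear f g) x = smear f (Δ g) x := by
  unfold lapl
  simp_rw [fderiv_smear_apply]
  rw [laplacian_eq_sum_hess]
  simp only [fderiv_fun_neg, neg_apply, fderiv_smear_apply, neg_neg]
  simp only [smear, map_sum]
  rfl

/-- Green's identity against a compactly supported Schwartz function. -/
theorem integral_mul_laplacian_eq {u : Sp N → ℝ} (hu : ContDiff ℝ 2 u) {θ : 𝓢(Sp N, ℝ)}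
    (hθ : HasCompactSupport θ) : ∫ x, u x * Δ θ x = ∫ x, lapl u x * θ x := by
  have hu1 : Differentiable ℝ u := hu.differentiable (by simp)
  have hc1 : ∀ v, ContDiff ℝ 1 fun z => fderiv ℝ u z v := fun v =>
    (hu.fderiv_right (m := 1) (by norm_num)).clm_apply contDiff_const
  have hu2 : ∀ v, Differentiable ℝ fun z => fderiv ℝ u z v := fun v =>
    (hc1 v).differentiable (by simp)
  have hc2 : ∀ v, Continuous fun z => fderiv ℝ (fun z => fderiv ℝ u z v) z v := fun v =>
    ((hc1 v).continuous_fderiv (by simp)).clm_apply continuous_const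
  have hd : ∀ (φ : 𝓢(Sp N, ℝ)) (m : Sp N), HasCompactSupport φ →
      HasCompactSupport (∂_{m} φ : 𝓢(Sp N, ℝ)) := fun φ m hφ => hφ.fderiv_apply ℝ m
  have hint : ∀ {w : Sp N → ℝ} {φ : 𝓢(Sp N, ℝ)}, Continuous w → HasCompactSupport φ →
      Integrable fun x => w x * φ x := fun hw hφ =>
    (hw.mul (SchwartzMap.continuous _)).integrable_of_hasCompactSupport hφ.mul_left
  have key : ∀ v : Sp N, ∫ x, u x * (∂_{v} (∂_{v} θ) : 𝓢(Sp N, ℝ)) x =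
      ∫ x, fderiv ℝ (fun z => fderiv ℝ u z v) x v * θ x := by
    intro v
    have h1 := integral_mul_fderiv_eq_neg_fderiv_mul_of_integrable (μ := volume) (f := u)
      (g := (∂_{v} θ : 𝓢(Sp N, ℝ))) (v := v)
      (hint (hc1 v).continuous (hd _ _ hθ)) (hint (φ := ∂_{v} (∂_{v} θ)) hu.continuous
        (hd _ _ (hd _ _ hθ))) (hint hu.continuous (hd _ _ hθ)) (fun x _ => hu1 x)
      (fun x _ => SchwartzMap.differentiableAt _)
    have h2 := integral_mul_fderiv_eq_neg_fderiv_mul_of_integrable (μ := volume)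
      (f := fun z => fderiv ℝ u z v) (g := θ) (v := v)
      (hint (hc2 v) hθ) (hint (φ := ∂_{v} θ) (hc1 v).continuous
        (hd _ _ hθ)) (hint (hc1 v).continuous hθ) (fun x _ => hu2 v x)
      (fun x _ => SchwartzMap.differentiableAt _)
    exact h1.trans (by rw [neg_eq_iff_eq_neg]; exact h2)
  have e1 : ∀ x, u x * Δ θ x = ∑ i, u x * hess i i θ x := by
    intro x
    rw [laplacian_eq_sum_hess, ← Finset.mul_sum]
    simp
  simp_rw [e1, lapl, Finset.sum_mul]
  rw [integral_finsetSum _ fun i _ =>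
      hint (φ := hess i i θ) hu.continuous (hd _ _ (hd _ _ hθ)),
    integral_finsetSum _ fun i _ => hint (hc2 _) hθ]
  exact Finset.sum_congr rfl fun i _ => key _

theorem integral_hess_mul (i j : Fin N) (η θ : 𝓢(Sp N, ℝ)) :
    ∫ x, hess i j η x * θ x = ∫ x, η x * hess i j θ x := by
  rw [hess_comm i j θ, hess_eq, hess_eq, SchwartzMap.integral_mul_lineDerivOp_right_eq_neg_left,
    SchwartzMap.integral_mul_lineDerivOp_right_eq_neg_left _ θ, neg_neg]

/-! ### Rescaled convolutions of a Hardy space distribution. -/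

/-- The discrete maximal function `sup_{n ≥ 1} |f * η_n|`. -/
def discreteMaximalFn (η : 𝓢(Sp N, ℝ)) (f : Distr N) (x : Sp N) : ℝ≥0∞ :=
  ⨆ n : ℕ, ENNReal.ofReal |f (kernelS η ((n : ℝ) + 1) (by positivity) x)|

theorem discreteMaximalFn_le (η : 𝓢(Sp N, ℝ)) (f : Distr N) (x : Sp N) :
    discreteMaximalFn η f x ≤ maximalFn η f x :=
  iSup_le fun n => le_iSup₂_of_le ((n : ℝ) + 1) (by positivity) le_rfl

/-- The rescaled convolution `x ↦ s^N (f * η_s)(s x)` with `s = n + 1`. -/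
def rescaled (η : 𝓢(Sp N, ℝ)) (f : Distr N) (n : ℕ) (x : Sp N) : ℝ :=
  smear f (dilate (-((n : ℝ) + 1)⁻¹) (neg_ne_zero.mpr (by positivity)) η) (((n : ℝ) + 1) • x)

theorem apply_kernelS (η : 𝓢(Sp N, ℝ)) (f : Distr N) (n : ℕ) (x : Sp N) :
    f (kernelS η ((n : ℝ) + 1) (by positivity) x) = (((n : ℝ) + 1) ^ N)⁻¹ *
      smear f (dilate (-((n : ℝ) + 1)⁻¹) (neg_ne_zero.mpr (by positivity)) η) x := by
  rw [kernelS_eq, map_smul]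
  rfl

theorem measurable_discreteMaximalFn (η : 𝓢(Sp N, ℝ)) (f : Distr N) :
    Measurable (discreteMaximalFn η f) := by
  refine Measurable.iSup fun n => ?_
  simp only [apply_kernelS]
  have := (contDiff_smear f (dilate (-((n : ℝ) + 1)⁻¹) (neg_ne_zero.mpr (by positivity)) η)
    0).continuous
  exact (continuous_const.mul this).abs.measurable.ennreal_ofReal

theorem contDiff_rescaled (η : 𝓢(Sp N, ℝ)) (f : Distr N) (n : ℕ) :
    ContDiff ℝ 2 (rescaled η f n) :=
  (contDiff_smear f _ 2).comp (contDiff_const_smul _)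

theorem exists_rescaled_le (η : 𝓢(Sp N, ℝ)) (f : Distr N) (n : ℕ) :
    ∃ (A : ℝ) (m : ℕ), 0 ≤ A ∧ ∀ x, |rescaled η f n x| ≤ A * (1 + ‖x‖) ^ m := by
  obtain ⟨A, m, hA, h⟩ := exists_smear_le f
    (dilate (-((n : ℝ) + 1)⁻¹) (neg_ne_zero.mpr (by positivity)) η)
  refine ⟨A * ((n : ℝ) + 1) ^ m, m, by positivity, fun x => (h _).trans ?_⟩
  rw [norm_smul, Real.norm_of_nonneg (by positivity), mul_assoc, ← mul_pow]
  gcongr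
  have : (0 : ℝ) ≤ n := Nat.cast_nonneg n
  nlinarith [norm_nonneg x]

theorem ofReal_abs_rescaled_le (η : 𝓢(Sp N, ℝ)) (f : Distr N) (n : ℕ) (x : Sp N) :
    ENNReal.ofReal |rescaled η f n x| ≤ ENNReal.ofReal (((n : ℝ) + 1) ^ N) *
      discreteMaximalFn η f (((n : ℝ) + 1) • x) := by
  have h := apply_kernelS η f n (((n : ℝ) + 1) • x)
  have e : rescaled η f n x = ((n : ℝ) + 1) ^ N *
      f (kernelS η ((n : ℝ) + 1) (by positivity) (((n : ℝ) + 1) • x)) := by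
    rw [h, ← mul_assoc, mul_inv_cancel₀ (by positivity), one_mul]
    rfl
  rw [e, abs_mul, abs_of_nonneg (by positivity), ENNReal.ofReal_mul (by positivity)]
  gcongr
  exact le_iSup (fun n : ℕ => ENNReal.ofReal |f (kernelS η ((n : ℝ) + 1) (by positivity) _)|) n

/-- With `s = n + 1`, the amplitude contributes `s^{Nq}` and the change of variables `s^{-N}`; their
product is at most 1 because `s ≥ 1` and `q ≤ 1`. The region `‖x‖ > a` is carried to `‖y‖ > sa`,
which escapes to infinity. -/
theorem lintegral_rescaled_le (η : 𝓢(Sp N, ℝ)) (f : Distr N) {q : ℝ} (hq : 0 < q) (hq1 : q ≤ 1)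
    (n : ℕ) (a : ℝ) :
    ∫⁻ x in {x | a < ‖x‖}, ENNReal.ofReal |rescaled η f n x| ^ q ≤
      ∫⁻ y in {y | ((n : ℝ) + 1) * a < ‖y‖}, discreteMaximalFn η f y ^ q := by
  set c : ℝ := (n : ℝ) + 1 with hc
  have hc1 : 1 ≤ c := by simp [hc]
  have hc0 : 0 < c := by linarith
  have hm : ∀ r : ℝ, MeasurableSet {x : Sp N | r < ‖x‖} := fun r =>
    measurableSet_lt measurable_const measurable_norm
  set K := ENNReal.ofReal (c ^ N) ^ q with hK
  rw [← lintegral_indicator (hm _), ← lintegral_indicator (hm _)]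
  set G : Sp N → ℝ≥0∞ := {y | c * a < ‖y‖}.indicator fun y => discreteMaximalFn η f y ^ q
  calc _ ≤ ∫⁻ x, K * G (c • x) := by
        refine lintegral_mono fun x => ?_
        by_cases hx : a < ‖x‖
        · have hx' : c * a < ‖c • x‖ := by
            rw [norm_smul, Real.norm_of_nonneg hc0.le]; gcongr
          rw [indicator_of_mem (by exact hx)]
          simp only [G]
          rw [indicator_of_mem (by exact hx'), hK, ← ENNReal.mul_rpow_of_nonneg _ _ hq.le]
          gcongr
          exact ofReal_abs_rescaled_le η f n x
        · rw [indicator_of_notMem (by exact hx)]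
          exact bot_le
    _ = K * (ENNReal.ofReal ((c ^ N)⁻¹) * ∫⁻ y, G y) := by
        rw [lintegral_const_mul, lintegral_comp_smul_Sp G hc0]
        exact (((measurable_discreteMaximalFn η f).pow_const q).indicator (hm _)).comp
          (measurable_const_smul c)
    _ = (K * ENNReal.ofReal ((c ^ N)⁻¹)) * ∫⁻ y, G y := by rw [mul_assoc]
    _ ≤ 1 * ∫⁻ y, G y := by
        gcongr
        have h1 : (1 : ℝ) ≤ c ^ N := one_le_pow₀ hc1
        calc K * ENNReal.ofReal ((c ^ N)⁻¹)
            ≤ ENNReal.ofReal (c ^ N) ^ (1 : ℝ) * ENNReal.ofReal ((c ^ N)⁻¹) := by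
              gcongr
              exact ENNReal.rpow_le_rpow_of_exponent_le (by simpa using h1) hq1
          _ = 1 := by
              rw [ENNReal.rpow_one, ← ENNReal.ofReal_mul (by positivity),
                mul_inv_cancel₀ (by positivity), ENNReal.ofReal_one]
    _ = _ := one_mul _

/-- Two derivatives of the dilated `η` cost `s^{-2}`, exactly cancelling the `s²` created by
rescaling the argument. This makes the Laplacians bounded and convergent as `n` grows. -/
theorem lapl_rescaled {F : Fin N → Fin N → Sp N → ℝ} (hF : ∀ i j, Integrable (F i j))
    {η : 𝓢(Sp N, ℝ)} {f : Distr N} {n : ℕ}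
    (hid : ∀ x, f (Δ (kernelS η ((n : ℝ) + 1) (by positivity) x)) =
      -hessPair F hF (kernelS η ((n : ℝ) + 1) (by positivity) x)) (x : Sp N) :
    lapl (rescaled η f n) x =
      -∑ i, ∑ j, ∫ y, F i j y * hess i j η (x + (-((n : ℝ) + 1)⁻¹) • y) := by
  set c : ℝ := (n : ℝ) + 1 with hc
  have hc0 : 0 < c := by positivity
  set g := dilate (-c⁻¹) (neg_ne_zero.mpr (inv_ne_zero hc0.ne')) η
  have h1 : lapl (rescaled η f n) x = c ^ 2 * smear f (Δ g) (c • x) := by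
    rw [← lapl_smear]
    exact lapl_comp_smul (contDiff_smear f _ 2) c x
  have h2 : smear f (Δ g) (c • x) = -hessPair F hF (SchwartzMap.compSubConstCLM ℝ (c • x) g) := by
    have := hid (c • x)
    rw [kernelS_eq, map_smul, ← SchwartzMap.laplacianCLM_eq ℝ, map_smul, map_smul,
      SchwartzMap.laplacianCLM_eq, laplacian_translate, smul_eq_mul, smul_eq_mul,
      ← mul_neg] at this
    exact mul_left_cancel₀ (by positivity) this
  rw [h1, h2, hessPair_apply, mul_neg, Finset.mul_sum]
  congr 1
  refine Finset.sum_congr rfl fun i _ => ?_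
  rw [Finset.mul_sum]
  refine Finset.sum_congr rfl fun j _ => ?_
  rw [← integral_const_mul]
  refine integral_congr_ae (.of_forall fun y => ?_)
  have e : -c⁻¹ • (y - c • x) = x + -c⁻¹ • y := by
    rw [smul_sub, smul_smul, neg_mul, inv_mul_cancel₀ hc0.ne']
    simp [sub_eq_add_neg, add_comm]
  simp only [hess_translate, SchwartzMap.compSubConstCLM_apply, g, hess_dilate]
  rw [smul_apply, dilate_apply, e, smul_eq_mul]
  field_simp

/-- An identity `f(Δψ) = -∑ ∫ F_ij ∂_i ∂_j ψ` for countably many truncated kernels extends to all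
kernels. -/
theorem kernelS_identity {F : Fin N → Fin N → Sp N → ℝ} (hF : ∀ i j, Integrable (F i j))
    {η : 𝓢(Sp N, ℝ)} {f : Distr N} {χ : Sp N → ℝ} (hχ : HasCompactSupport χ)
    (hχ' : ContDiff ℝ ∞ χ) (hχ1 : ∀ x, ‖x‖ ≤ 1 → χ x = 1) {n : ℕ}
    (hid : ∀ l R : ℕ, ∀ ψ, ψ = cutoffMul hχ hχ' ((R : ℝ) + 1)⁻¹ (by positivity)
        (kernelS η ((n : ℝ) + 1) (by positivity) (TopologicalSpace.denseSeq (Sp N) l)) →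
      f (Δ ψ) = -hessPair F hF ψ) (x : Sp N) :
    f (Δ (kernelS η ((n : ℝ) + 1) (by positivity) x)) =
      -hessPair F hF (kernelS η ((n : ℝ) + 1) (by positivity) x) := by
  set Λ : Distr N := f.comp (laplacianCLM ℝ (Sp N) 𝓢(Sp N, ℝ)) + hessPair F hF
  have hΛ : ∀ ψ, Λ ψ = f (Δ ψ) + hessPair F hF ψ := fun ψ => by
    simp [Λ]
  suffices h : ∀ x, Λ (kernelS η ((n : ℝ) + 1) (by positivity) x) = 0 by
    have := h x
    rw [hΛ] at this
    linarith
  have hdense : ∀ l, Λ (kernelS η ((n : ℝ) + 1) (by positivity)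
      (TopologicalSpace.denseSeq (Sp N) l)) = 0 := by
    intro l
    have h1 := (Λ.continuous.tendsto _).comp (tendsto_cutoffMul hχ hχ' hχ1
      (kernelS η ((n : ℝ) + 1) (by positivity) (TopologicalSpace.denseSeq (Sp N) l)))
    refine tendsto_nhds_unique h1 (tendsto_const_nhds.congr fun R => ?_)
    simp only [Function.comp_apply]
    rw [hΛ, hid l R _ rfl, neg_add_cancel]
  have hcont : Continuous fun x => Λ (kernelS η ((n : ℝ) + 1) (by positivity) x) := by
    simp only [apply_kernelS]
    exact continuous_const.mul (contDiff_smear Λ _ 0).continuous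
  have := hcont.ext_on (TopologicalSpace.denseRange_denseSeq (Sp N)) continuous_const
    (g := fun _ => 0) (by rintro _ ⟨l, rfl⟩; exact hdense l)
  exact fun x => congrFun this x

/-- The exterior regions decrease to the empty set, so this is continuity from above of the finite
measure with density `m`. -/
theorem tendsto_setLIntegral_norm_gt {m : Sp N → ℝ≥0∞} (hm : ∫⁻ y, m y ≠ ⊤)
    {a : ℝ} (ha : 0 < a) :
    Tendsto (fun n : ℕ => ∫⁻ y in {y | ((n : ℝ) + 1) * a < ‖y‖}, m y) atTop (𝓝 0) := by
  set s : ℕ → Set (Sp N) := fun n => {y | ((n : ℝ) + 1) * a < ‖y‖}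
  have hs : ∀ n, MeasurableSet (s n) := fun n => measurableSet_lt measurable_const measurable_norm
  have hanti : Antitone s := by
    intro n k hnk y hy
    simp only [s, mem_ofPred_eq] at hy ⊢
    refine lt_of_le_of_lt ?_ hy
    gcongr
  have hempty : ⋂ n, s n = ∅ := by
    ext y
    simp only [mem_iInter, mem_empty_iff_false, iff_false, not_forall]
    obtain ⟨n, hn⟩ := exists_nat_gt (‖y‖ / a)
    refine ⟨n, ?_⟩
    rw [div_lt_iff₀ ha] at hn
    simp only [s, mem_ofPred_eq, not_lt]
    nlinarith
  have h := tendsto_measure_iInter_atTop (μ := volume.withDensity m)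
    (fun n => (hs n).nullMeasurableSet) hanti ⟨0, ?_⟩
  · rw [hempty, measure_empty] at h
    exact h.congr fun n => withDensity_apply _ (hs n)
  · rw [withDensity_apply _ (hs 0)]
    exact ((setLIntegral_le_lintegral _ _).trans_lt hm.lt_top).ne

/-- Inside the ball only the sup bounds are used. Outside it, `|u| = |u|^{1-q}|u|^q ≤ B^{1-q}|u|^q`
converts the `L^q` tail into an `L¹` bound. -/
theorem abs_integral_mul_le_of_bound {u θ : Sp N → ℝ} (hu : Continuous u) (hθi : Integrable θ)
    {B K q a : ℝ} (hq1 : q ≤ 1) (hB : ∀ x, |u x| ≤ B) (hK : ∀ x, |θ x| ≤ K)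
    {t : ℝ≥0∞} (ht : t ≠ ⊤) (htail : ∫⁻ x in {x | a < ‖x‖}, ENNReal.ofReal |u x| ^ q ≤ t) (hq : 0 < q) :
    |∫ x, u x * θ x| ≤ B * K * volume.real (Metric.closedBall (0 : Sp N) a) +
      B ^ (1 - q) * K * t.toReal := by
  have hB0 : 0 ≤ B := (abs_nonneg _).trans (hB 0)
  have hK0 : 0 ≤ K := (abs_nonneg _).trans (hK 0)
  have hint : Integrable fun x => u x * θ x :=
    hθi.bdd_mul hu.aestronglyMeasurable (.of_forall hB)
  have hms : MeasurableSet (Metric.closedBall (0 : Sp N) a) := measurableSet_closedBall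
  have hcompl : (Metric.closedBall (0 : Sp N) a)ᶜ = {x | a < ‖x‖} := by
    ext x; simp
  rw [← integral_add_compl hms hint]
  refine (abs_add_le _ _).trans (add_le_add ?_ ?_)
  · rw [← Real.norm_eq_abs]
    refine norm_setIntegral_le_of_norm_le_const
      (isCompact_closedBall (0 : Sp N) a).measure_lt_top fun x _ => ?_
    rw [norm_mul, Real.norm_eq_abs, Real.norm_eq_abs]
    exact mul_le_mul (hB x) (hK x) (abs_nonneg _) hB0
  · rw [hcompl]
    have hmeas : Measurable fun x => |u x| ^ q := hu.abs.measurable.pow_const q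
    have hl : ∫⁻ x in {x | a < ‖x‖}, ENNReal.ofReal (|u x| ^ q) ≤ t := by
      simp_rw [← ENNReal.ofReal_rpow_of_nonneg (abs_nonneg _) hq.le]
      exact htail
    have hi : IntegrableOn (fun x => |u x| ^ q) {x | a < ‖x‖} := by
      refine ⟨hmeas.aestronglyMeasurable, ?_⟩
      rw [hasFiniteIntegral_iff_ofReal (.of_forall fun y => by positivity)]
      exact hl.trans_lt ht.lt_top
    have hle : ∫ x in {x | a < ‖x‖}, |u x| ^ q ≤ t.toReal := by
      rw [integral_eq_lintegral_of_nonneg_ae (.of_forall fun y => by positivity)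
        hmeas.aestronglyMeasurable]
      exact ENNReal.toReal_mono ht hl
    calc _ ≤ ∫ x in {x | a < ‖x‖}, B ^ (1 - q) * K * |u x| ^ q := by
          rw [← Real.norm_eq_abs]
          refine norm_integral_le_of_norm_le (hi.const_mul _) (.of_forall fun x => ?_)
          rw [norm_mul, Real.norm_eq_abs, Real.norm_eq_abs]
          have e : |u x| = |u x| ^ (1 - q) * |u x| ^ q := by
            rcases (abs_nonneg (u x)).eq_or_lt with h | h
            · rw [← h, Real.zero_rpow hq.ne', mul_zero]
            · rw [← Real.rpow_add h]; simp
          calc |u x| * |θ x| = |u x| ^ (1 - q) * |u x| ^ q * |θ x| := by rw [← e]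
            _ ≤ B ^ (1 - q) * |u x| ^ q * K := by
                have h1 : |u x| ^ (1 - q) ≤ B ^ (1 - q) :=
                  Real.rpow_le_rpow (abs_nonneg _) (hB x) (sub_nonneg.2 hq1)
                exact mul_le_mul (mul_le_mul_of_nonneg_right h1 (by positivity)) (hK x)
                  (abs_nonneg _) (by positivity)
            _ = _ := by ring
      _ = B ^ (1 - q) * K * ∫ x in {x | a < ‖x‖}, |u x| ^ q := integral_const_mul _ _
      _ ≤ _ := by gcongr

/-- The rescaled convolutions are uniformly bounded and their `L^q` mass concentrates at the origin,
so they tend to zero as distributions, and so do their Laplacians. The limit of the Laplacians is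
also computable from `F`, and it must vanish. -/
theorem sum_integral_mul_hess_eq_zero (hN : 1 ≤ N) {F : Fin N → Fin N → Sp N → ℝ}
    (hF : ∀ i j, Integrable (F i j)) {η : 𝓢(Sp N, ℝ)} {f : Distr N} {q : ℝ} (hq : 0 < q)
    (hq1 : q ≤ 1) (hf : hardyNorm η q f < ⊤)
    (hid : ∀ (n : ℕ) x, f (Δ (kernelS η ((n : ℝ) + 1) (by positivity) x)) =
      -hessPair F hF (kernelS η ((n : ℝ) + 1) (by positivity) x))
    {θ : 𝓢(Sp N, ℝ)} (hθ : HasCompactSupport θ) :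
    ∑ i, ∑ j, (∫ y, F i j y) * ∫ x, hess i j η x * θ x = 0 := by
  have hm : ∫⁻ x, discreteMaximalFn η f x ^ q ≠ ⊤ := by
    have h1 : ∫⁻ x, maximalFn η f x ^ q < ⊤ := by
      by_contra h
      rw [hardyNorm, not_lt_top_iff.1 h, ENNReal.top_rpow_of_pos (by positivity)] at hf
      exact lt_irrefl _ hf
    refine ((lintegral_mono fun x => ?_).trans_lt h1).ne
    exact ENNReal.rpow_le_rpow (discreteMaximalFn_le η f x) hq.le
  set D : ℝ := ∑ i, ∑ j, (∫ y, |F i j y|) * SchwartzMap.seminorm ℝ 0 0 (hess i j η)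
  have hD : ∀ n x, |lapl (rescaled η f n) x| ≤ D := by
    intro n x
    rw [lapl_rescaled hF (hid n), abs_neg]
    refine (Finset.abs_sum_le_sum_abs _ _).trans (Finset.sum_le_sum fun i _ => ?_)
    refine (Finset.abs_sum_le_sum_abs _ _).trans (Finset.sum_le_sum fun j _ => ?_)
    exact abs_integral_mul_le (hF i j) fun y => abs_le_seminorm _ _
  obtain ⟨B, hB0, hB⟩ := exists_uniform_bound hN D (∫⁻ x, discreteMaximalFn η f x ^ q).toReal q
    ((abs_nonneg _).trans (hD 0 0)) ENNReal.toReal_nonneg hq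
  have hBn : ∀ n x, |rescaled η f n x| ≤ B := by
    intro n
    refine hB _ (contDiff_rescaled η f n) (hD n) ?_ (exists_rescaled_le η f n)
    rw [ENNReal.ofReal_toReal hm]
    -- The value `a = -1` makes the exterior region the whole space.
    have h := lintegral_rescaled_le η f hq hq1 n (-1)
    have huniv : {x : Sp N | -1 < ‖x‖} = univ :=
      eq_univ_of_forall fun x => lt_of_lt_of_le (by norm_num) (norm_nonneg x)
    rw [huniv, setLIntegral_univ] at h
    exact h.trans (setLIntegral_le_lintegral _ _)
  set H : Sp N → ℝ := fun x => -∑ i, ∑ j, (∫ y, F i j y) * hess i j η x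
  have hlim : Tendsto (fun n => ∫ x, rescaled η f n x * Δ θ x) atTop (𝓝 (∫ x, H x * θ x)) := by
    simp_rw [integral_mul_laplacian_eq (contDiff_rescaled η f _) hθ]
    have hc : Tendsto (fun n : ℕ => -((n : ℝ) + 1)⁻¹) atTop (𝓝 0) := by
      simpa using (tendsto_one_div_add_atTop_nhds_zero_nat (𝕜 := ℝ)).neg
    refine tendsto_integral_of_dominated_convergence (fun x => D * |θ x|) (fun n => ?_)
      (θ.integrable.abs.const_mul D) (fun n => .of_forall fun x => ?_) (.of_forall fun x => ?_)
    · have hl : Continuous (lapl (rescaled η f n)) := by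
        refine continuous_finsetSum _ fun i _ => ?_
        have h1 : ContDiff ℝ 1 fun z => fderiv ℝ (rescaled η f n) z (EuclideanSpace.single i 1) :=
          ((contDiff_rescaled η f n).fderiv_right (m := 1) (by norm_num)).clm_apply contDiff_const
        exact (h1.continuous_fderiv (by simp)).clm_apply continuous_const
      exact (hl.mul θ.continuous).aestronglyMeasurable
    · rw [norm_mul, Real.norm_eq_abs, Real.norm_eq_abs]
      gcongr
      exact hD n x
    · refine Tendsto.mul_const _ ?_
      simp_rw [lapl_rescaled hF (hid _)]
      exact (tendsto_finsetSum _ fun i _ => tendsto_finsetSum _ fun j _ =>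
        tendsto_integral_mul_comp_smul (hF i j) (hess i j η) hc x).neg
  set K := SchwartzMap.seminorm ℝ 0 0 (Δ θ)
  -- For fixed `a`, letting `n → ∞` kills the exterior contribution; the ball contribution is then
  -- removed by `a → 0`.
  have hbd : ∀ a, 0 < a →
      |∫ x, H x * θ x| ≤ B * K * volume.real (Metric.closedBall (0 : Sp N) a) := by
    intro a ha
    have ht := tendsto_setLIntegral_norm_gt hm ha
    have ht' := (ENNReal.tendsto_toReal ENNReal.zero_ne_top).comp ht
    have h1 := (ht'.const_mul (B ^ (1 - q) * K)).const_add
      (B * K * volume.real (Metric.closedBall (0 : Sp N) a))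
    rw [ENNReal.toReal_zero, mul_zero, add_zero] at h1
    refine le_of_tendsto_of_tendsto' hlim.abs h1 fun n => ?_
    exact abs_integral_mul_le_of_bound (contDiff_rescaled η f n).continuous (Δ θ).integrable hq1
      (hBn n) (abs_le_seminorm _)
      ((setLIntegral_le_lintegral _ _).trans_lt hm.lt_top).ne
      (lintegral_rescaled_le η f hq hq1 n a) hq
  have hzero : ∫ x, H x * θ x = 0 := by
    have hv : Tendsto (fun a : ℝ => B * K * (a ^ N * volume.real (Metric.ball (0 : Sp N) 1)))
        (𝓝[>] 0) (𝓝 (B * K * (0 ^ N * volume.real (Metric.ball (0 : Sp N) 1)))) :=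
      (Continuous.tendsto (by fun_prop) 0).mono_left nhdsWithin_le_nhds
    rw [zero_pow (by lia), zero_mul, mul_zero] at hv
    refine abs_nonpos_iff.1 (ge_of_tendsto hv ?_)
    filter_upwards [self_mem_nhdsWithin] with a ha
    refine (hbd a ha).trans_eq ?_
    rw [Measure.real, Measure.addHaar_closedBall _ _ (le_of_lt ha)]
    simp [Measure.real, ENNReal.toReal_mul, ENNReal.toReal_ofReal (pow_nonneg (le_of_lt ha) N)]
  have e : ∀ x, H x * θ x = -∑ i, ∑ j, (∫ y, F i j y) * (hess i j η x * θ x) := by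
    intro x
    simp only [H, neg_mul, Finset.sum_mul, mul_assoc]
  have hi : ∀ i j, Integrable fun x => (∫ y, F i j y) * (hess i j η x * θ x) := fun i j =>
    (integrable_mul_schwartz (hess i j η).integrable θ).const_mul _
  simp_rw [e] at hzero
  rw [integral_neg, neg_eq_zero, integral_finsetSum _ fun i _ => integrable_finsetSum _ fun j _ =>
    hi i j] at hzero
  rw [← hzero]
  refine Finset.sum_congr rfl fun i _ => ?_
  rw [integral_finsetSum _ fun j _ => hi i j]
  exact Finset.sum_congr rfl fun j _ => (integral_const_mul _ _).symm

/-! ### Diagonal integrals from dilated local squares. -/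

/-- The dilate `x ↦ Ψ(x / (n + 1))`. -/
def natDilate (Ψ : 𝓢(Sp N, ℝ)) (n : ℕ) : 𝓢(Sp N, ℝ) :=
  dilate ((n : ℝ) + 1)⁻¹ (by positivity) Ψ

theorem hasCompactSupport_natDilate {Ψ : 𝓢(Sp N, ℝ)} (hΨ : HasCompactSupport Ψ) (n : ℕ) :
    HasCompactSupport (natDilate Ψ n) := by
  have hc : ((n : ℝ) + 1)⁻¹ ≠ 0 := by positivity
  have e : (natDilate Ψ n : Sp N → ℝ) = fun x => Ψ (((n : ℝ) + 1)⁻¹ • x) :=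
    funext fun x => dilate_apply _ hc Ψ x
  rw [e]
  exact hΨ.comp_smul hc

theorem hess_natDilate (Ψ : 𝓢(Sp N, ℝ)) (n : ℕ) (i j : Fin N) (x : Sp N) :
    hess i j (natDilate Ψ n) x = (((n : ℝ) + 1)⁻¹) ^ 2 *
      hess i j Ψ (0 + ((n : ℝ) + 1)⁻¹ • x) := by
  rw [natDilate, hess_dilate, zero_add]
  rfl

theorem tendsto_inv_nat_add_one : Tendsto (fun n : ℕ => ((n : ℝ) + 1)⁻¹) atTop (𝓝 0) := by
  simpa using (tendsto_one_div_add_atTop_nhds_zero_nat (𝕜 := ℝ))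

theorem sum_mul_localSquare (G : Fin N → Fin N → ℝ) (k : Fin N) {h : Fin N → Fin N → ℝ}
    (hh : ∀ i j, h i j = if i = k ∧ j = k then 2 else 0) :
    ∑ i, ∑ j, G i j * h i j = 2 * G k k := by
  simp only [hh]
  rw [Finset.sum_eq_single k, Finset.sum_eq_single k]
  · simp [mul_comm]
  · intro j _ hj; simp [hj]
  · simp
  · intro i _ hi; simp [hi]
  · simp

/-- The Hardy space case: the diagonal entries have vanishing integral. -/
theorem integral_diag_eq_zero_of_hardy (hN : 1 ≤ N) {F : Fin N → Fin N → Sp N → ℝ}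
    (hF : ∀ i j, Integrable (F i j)) {η : 𝓢(Sp N, ℝ)} (hη : ∫ x, η x ≠ 0) {f : Distr N} {q : ℝ}
    (hq : 0 < q) (hq1 : q ≤ 1) (hf : hardyNorm η q f < ⊤)
    (hid : ∀ (n : ℕ) x, f (Δ (kernelS η ((n : ℝ) + 1) (by positivity) x)) =
      -hessPair F hF (kernelS η ((n : ℝ) + 1) (by positivity) x)) (k : Fin N) :
    ∫ x, F k k x = 0 := by
  obtain ⟨Ψ, hΨ, hΨ2⟩ := exists_localSquare hN k
  have h1 : ∀ n : ℕ, ∑ i, ∑ j, (∫ y, F i j y) *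
      ∫ x, η x * hess i j Ψ (0 + ((n : ℝ) + 1)⁻¹ • x) = 0 := by
    intro n
    have h := sum_integral_mul_hess_eq_zero hN hF hq hq1 hf hid
      (hasCompactSupport_natDilate hΨ n)
    have hc : (((n : ℝ) + 1)⁻¹) ^ 2 ≠ 0 := by positivity
    refine mul_left_cancel₀ hc ?_
    rw [mul_zero, ← h, Finset.mul_sum]
    refine Finset.sum_congr rfl fun i _ => ?_
    rw [Finset.mul_sum]
    refine Finset.sum_congr rfl fun j _ => ?_
    rw [integral_hess_mul]
    simp_rw [hess_natDilate, mul_left_comm (η _)]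
    rw [integral_const_mul]
    ring
  -- Here the roles are exchanged: `η` is the integrable function whose mass survives, and the
  -- Hessian of `Ψ` is evaluated at the origin.
  have h2 := tendsto_finsetSum Finset.univ fun i _ => tendsto_finsetSum Finset.univ fun j _ =>
    (tendsto_integral_mul_comp_smul η.integrable (hess i j Ψ) tendsto_inv_nat_add_one 0).const_mul
      (∫ y, F i j y)
  simp_rw [h1] at h2
  have h3 := tendsto_nhds_unique h2 tendsto_const_nhds
  simp_rw [← mul_assoc] at h3
  rw [sum_mul_localSquare _ k hΨ2] at h3
  have h4 : (∫ x, F k k x) * ∫ x, η x = 0 := by linarith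
  exact (mul_eq_zero.1 h4).resolve_right hη

/-- The case of an integrable pressure `g`: the diagonal entries have integral `-∫ g`. -/
theorem integral_diag_eq_neg_of_integrable {F : Fin N → Fin N → Sp N → ℝ}
    (hF : ∀ i j, Integrable (F i j)) {g : Sp N → ℝ} (hg : Integrable g) {k : Fin N}
    {Ψ : 𝓢(Sp N, ℝ)} (hΨ2 : ∀ i j, hess i j Ψ 0 = if i = k ∧ j = k then 2 else 0)
    (hid : ∀ n : ℕ, ∫ x, g x * Δ (natDilate Ψ n) x = -hessPair F hF (natDilate Ψ n)) :
    ∫ x, F k k x = -∫ x, g x := by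
  have h1 : ∀ n : ℕ, (∑ i, ∫ x, g x * hess i i Ψ (0 + ((n : ℝ) + 1)⁻¹ • x)) +
      ∑ i, ∑ j, ∫ x, F i j x * hess i j Ψ (0 + ((n : ℝ) + 1)⁻¹ • x) = 0 := by
    intro n
    have hc : (((n : ℝ) + 1)⁻¹) ^ 2 ≠ 0 := by positivity
    refine mul_left_cancel₀ hc ?_
    have h := hid n
    have e : ∀ x, g x * Δ (natDilate Ψ n) x = ∑ i, g x * hess i i (natDilate Ψ n) x := by
      intro x
      rw [laplacian_eq_sum_hess, ← Finset.mul_sum]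
      simp
    simp_rw [e] at h
    rw [integral_finsetSum _ fun i _ => integrable_mul_schwartz hg _, hessPair_apply] at h
    simp_rw [hess_natDilate, mul_left_comm (g _), mul_left_comm (F _ _ _),
      integral_const_mul, ← Finset.mul_sum] at h
    rw [mul_zero, mul_add]
    linarith
  -- Since `ΔΨ(0) = 2`, the pressure sum tends to `2∫ g`, while the tensor sum tends to `2∫ F_kk`.
  have h2 := (tendsto_finsetSum Finset.univ fun i _ =>
    (tendsto_integral_mul_comp_smul hg (hess i i Ψ) tendsto_inv_nat_add_one 0)).add
    (tendsto_finsetSum Finset.univ fun i _ => tendsto_finsetSum Finset.univ fun j _ =>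
    (tendsto_integral_mul_comp_smul (hF i j) (hess i j Ψ) tendsto_inv_nat_add_one 0))
  simp_rw [h1] at h2
  have h3 := tendsto_nhds_unique h2 tendsto_const_nhds
  rw [sum_mul_localSquare _ k hΨ2] at h3
  simp only [hΨ2, and_self, mul_ite, mul_zero, Finset.sum_ite_eq', Finset.mem_univ, if_true] at h3
  linarith

/-! ### Gradient test fields and the pressure equation. -/

theorem gradient_apply_coord (ψ : Sp N → ℝ) (x : Sp N) (j : Fin N) :
    gradient ψ x j = fderiv ℝ ψ x (EuclideanSpace.single j 1) := by
  have h := EuclideanSpace.inner_single_right (𝕜 := ℝ) j 1 (gradient ψ x)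
  rw [inner_gradient_left] at h
  simpa using h.symm

theorem isSpaceTest_gradient {ψ : 𝓢(Sp N, ℝ)} (hψ : HasCompactSupport ψ) :
    IsSpaceTest (gradient (ψ : Sp N → ℝ)) where
  contDiff := by
    have h : ContDiff ℝ ∞ (fderiv ℝ ψ) := (ψ.smooth ⊤).fderiv_right (by simp)
    exact (InnerProductSpace.toDual ℝ (Sp N)).symm.contDiff.comp h
  compact := (hψ.fderiv (𝕜 := ℝ)).comp_left (g := (InnerProductSpace.toDual ℝ (Sp N)).symm)
    (map_zero _)

theorem pd_gradient {ψ : 𝓢(Sp N, ℝ)} (hψ : HasCompactSupport ψ) (i j : Fin N) (x : Sp N) :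
    pd i j (gradient (ψ : Sp N → ℝ)) x = hess i j ψ x := by
  have hd : DifferentiableAt ℝ (gradient (ψ : Sp N → ℝ)) x :=
    (isSpaceTest_gradient hψ).contDiff.differentiable (by simp) x
  have h := ((EuclideanSpace.proj j : Sp N →L[ℝ] ℝ).hasFDerivAt.comp x hd.hasFDerivAt).fderiv
  have e : ((EuclideanSpace.proj j : Sp N →L[ℝ] ℝ) ∘ gradient (ψ : Sp N → ℝ)) =
      fun y => fderiv ℝ ψ y (EuclideanSpace.single j 1) :=
    funext fun y => gradient_apply_coord ψ y j
  rw [e] at h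
  rw [hess_apply, h]
  rfl

theorem divg_gradient {ψ : 𝓢(Sp N, ℝ)} (hψ : HasCompactSupport ψ) (x : Sp N) :
    divg (gradient (ψ : Sp N → ℝ)) x = Δ ψ x := by
  simp [divg, pd_gradient hψ, laplacian_eq_sum_hess]

theorem divS_gradient {ψ : 𝓢(Sp N, ℝ)} (hψ : HasCompactSupport ψ) :
    divS (isSpaceTest_gradient hψ) = Δ ψ := by
  ext x
  exact divg_gradient hψ x

/-- The Laplacian of a gradient field is again the gradient of a compactly supported Schwartz
function, which is why the viscous term is annihilated by `div v = 0`. -/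
theorem laplacian_gradient {ψ : 𝓢(Sp N, ℝ)} (hψ : HasCompactSupport ψ) :
    Laplacian.laplacian (gradient (ψ : Sp N → ℝ)) = gradient (Δ ψ : 𝓢(Sp N, ℝ)) := by
  ext x j
  have hc : ContDiffAt ℝ 2 (gradient (ψ : Sp N → ℝ)) x :=
    (contDiff_infty.1 (isSpaceTest_gradient hψ).contDiff 2).contDiffAt
  have h := hc.laplacian_CLM_comp_left (l := (EuclideanSpace.proj j : Sp N →L[ℝ] ℝ))
  have e : ((EuclideanSpace.proj j : Sp N →L[ℝ] ℝ) ∘ gradient (ψ : Sp N → ℝ)) =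
      (∂_{EuclideanSpace.single j (1 : ℝ)} ψ : 𝓢(Sp N, ℝ)) :=
    funext fun y => gradient_apply_coord ψ y j
  rw [e, ← SchwartzMap.laplacian_apply] at h
  rw [gradient_apply_coord]
  refine Eq.trans h.symm ?_
  rw [← SchwartzMap.lineDerivOp_apply_eq_fderiv, laplacian_eq_sum_hess, laplacian_eq_sum_hess,
    lineDerivOp_sum]
  simp only [hess_eq]
  congr 2
  ext1 i
  rw [lineDerivOp_comm _ (EuclideanSpace.single i 1) (EuclideanSpace.single j 1),
    lineDerivOp_comm _ (EuclideanSpace.single i 1) (EuclideanSpace.single j 1)]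

theorem hasCompactSupport_laplacian {ψ : 𝓢(Sp N, ℝ)} (hψ : HasCompactSupport ψ) :
    HasCompactSupport (Δ ψ : 𝓢(Sp N, ℝ)) := by
  have e : ((Δ ψ : 𝓢(Sp N, ℝ)) : Sp N → ℝ) = divg (gradient (ψ : Sp N → ℝ)) :=
    funext fun x => (divg_gradient hψ x).symm
  rw [e]
  exact hasCompactSupport_divg (isSpaceTest_gradient hψ)

theorem pair_gradient_eq_zero {T : ℝ} {u : ℝ → Sp N → Sp N} (hu : MemL1L2σ T u)
    {ψ : 𝓢(Sp N, ℝ)} (hψ : HasCompactSupport ψ) :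
    ∀ᵐ t ∂(volume.restrict (Ioo 0 T)), pair u (gradient (ψ : Sp N → ℝ)) t = 0 := by
  filter_upwards [hu.div_free] with t ht
  exact ht ψ (ψ.smooth ⊤) hψ

/-- The fundamental lemma of the calculus of variations on `(0,T)`. -/
theorem ae_eq_zero_of_integral_timeTest {T : ℝ} {h : ℝ → ℝ}
    (hi : ∀ ξ, IsTimeTest T ξ → IntegrableOn (fun t => h t * ξ t) (Ioo 0 T))
    (h0 : ∀ ξ, IsTimeTest T ξ → ∫ t in Ioo 0 T, h t * ξ t = 0) :
    ∀ᵐ t ∂(volume.restrict (Ioo 0 T)), h t = 0 := by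
  rw [ae_restrict_iff' measurableSet_Ioo]
  refine isOpen_Ioo.ae_eq_zero_of_integral_contDiff_smul_eq_zero ?_ fun g hg hgc hgs => ?_
  · intro t ht
    obtain ⟨ε, hε, hεs⟩ := Metric.isOpen_iff.1 isOpen_Ioo t ht
    -- Only products with test functions are known to be integrable; a bump equal to 1 near `t`
    -- recovers local integrability of `h` itself.
    let ξ : ContDiffBump t := ⟨ε / 4, ε / 2, by positivity, by linarith⟩
    have hξ : IsTimeTest T ξ := by
      refine ⟨ξ.contDiff, ξ.hasCompactSupport, ?_⟩
      rw [ξ.tsupport_eq]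
      exact (Metric.closedBall_subset_ball (by simp only [ξ]; linarith)).trans hεs
    have hsub : Metric.ball t (ε / 4) ⊆ Ioo 0 T :=
      (Metric.ball_subset_ball (by linarith)).trans hεs
    refine ⟨Metric.ball t (ε / 4),
      mem_nhdsWithin_of_mem_nhds (Metric.ball_mem_nhds t (by positivity)), ?_⟩
    refine ((hi ξ hξ).mono_set hsub).congr_fun (fun s hs => ?_) measurableSet_ball
    have : ξ s = 1 := ξ.one_of_mem_closedBall (Metric.ball_subset_closedBall hs)
    simp [this]
  · have hξ : IsTimeTest T g := ⟨hg.of_le (by exact_mod_cast le_top), hgc, hgs⟩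
    rw [← h0 g hξ]
    rw [setIntegral_eq_integral_of_forall_compl_eq_zero]
    · simp only [smul_eq_mul, mul_comm]
    · intro t ht
      rw [image_eq_zero_of_notMem_tsupport (fun h => ht (hgs h)), mul_zero]

theorem IsTimeTest.integrableOn_mul {T : ℝ} {ξ : ℝ → ℝ} (hξ : IsTimeTest T ξ) {h : ℝ → ℝ}
    (hh : IntegrableOn h (Ioo 0 T)) : IntegrableOn (fun t => h t * ξ t) (Ioo 0 T) := by
  obtain ⟨C, hC⟩ := hξ.contDiff.continuous.bounded_above_of_compact_support hξ.compact
  exact hh.mul_bdd hξ.contDiff.continuous.aestronglyMeasurable (.of_forall hC)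

/-- The pressure equation at almost every time. -/
theorem IsWeakSolution.pressure_eq {μ ν T : ℝ} {v b : ℝ → Sp N → Sp N} {p : ℝ → Distr N}
    (hsol : IsWeakSolution μ ν T v b p) {ψ : 𝓢(Sp N, ℝ)} (hψ : HasCompactSupport ψ) :
    ∀ᵐ t ∂(volume.restrict (Ioo 0 T)), p t (Δ ψ) =
      -(tens v v (gradient (ψ : Sp N → ℝ)) t - tens b b (gradient (ψ : Sp N → ℝ)) t
        + 1 / 2 * magn b (gradient (ψ : Sp N → ℝ)) t) := by
  set φ := gradient (ψ : Sp N → ℝ)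
  have hφ : IsSpaceTest φ := isSpaceTest_gradient hψ
  have key : ∀ᵐ t ∂(volume.restrict (Ioo 0 T)),
      tens v v φ t - tens b b φ t + p t (Δ ψ) + 1 / 2 * magn b φ t = 0 := by
    have hint : ∀ ξ, IsTimeTest T ξ →
        IntegrableOn (fun t => tens v v φ t * ξ t - tens b b φ t * ξ t + p t (Δ ψ) * ξ t) (Ioo 0 T) ∧
        IntegrableOn (fun t => 1 / 2 * (magn b φ t * ξ t)) (Ioo 0 T) := fun ξ hξ =>
      ⟨((hsol.int_vv φ ξ hφ hξ).sub (hsol.int_bb φ ξ hφ hξ)).add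
        (hξ.integrableOn_mul (hsol.mem_p _)), (hsol.int_magn φ ξ hφ hξ).const_mul _⟩
    have e : ∀ ξ : ℝ → ℝ, (fun t => (tens v v φ t - tens b b φ t + p t (Δ ψ)
        + 1 / 2 * magn b φ t) * ξ t) = fun t => (tens v v φ t * ξ t - tens b b φ t * ξ t
          + p t (Δ ψ) * ξ t) + 1 / 2 * (magn b φ t * ξ t) := fun ξ => by
      ext t; ring
    refine ae_eq_zero_of_integral_timeTest (fun ξ hξ => ?_) fun ξ hξ => ?_
    · rw [e]
      exact (hint ξ hξ).1.add (hint ξ hξ).2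
    · have hsub : IntegrableOn (fun t => tens v v φ t * ξ t - tens b b φ t * ξ t) (Ioo 0 T) :=
        (hsol.int_vv φ ξ hφ hξ).sub (hsol.int_bb φ ξ hφ hξ)
      rw [e, integral_add (hint ξ hξ).1 (hint ξ hξ).2,
        integral_add hsub (hξ.integrableOn_mul (hsol.mem_p _)),
        integral_sub (hsol.int_vv φ ξ hφ hξ) (hsol.int_bb φ ξ hφ hξ), integral_const_mul]
      have h := hsol.momentum φ ξ hφ hξ
      have z1 : ∫ t in Ioo 0 T, pair v φ t * deriv ξ t = 0 := by
        refine integral_eq_zero_of_ae ?_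
        filter_upwards [pair_gradient_eq_zero hsol.mem_v hψ] with t ht
        simp [φ, ht]
      have z2 : ∫ t in Ioo 0 T, pair v (Laplacian.laplacian φ) t * ξ t = 0 := by
        refine integral_eq_zero_of_ae ?_
        filter_upwards [pair_gradient_eq_zero hsol.mem_v (hasCompactSupport_laplacian hψ)] with t ht
        simp only [φ]
        rw [laplacian_gradient hψ, ht, zero_mul, Pi.zero_apply]
      rw [z1, z2, divS_gradient hψ] at h
      linarith
  filter_upwards [key] with t ht
  linarith

/-! ### The stress tensor and the conclusion. -/

/-- The tensor `v ⊗ v - b ⊗ b + ½ |b|² I`. -/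
def stress (v b : Sp N → Sp N) (i j : Fin N) (x : Sp N) : ℝ :=
  v x i * v x j - b x i * b x j + if i = j then 1 / 2 * ‖b x‖ ^ 2 else 0

theorem memLp_coord {v : Sp N → Sp N} (hv : MemLp v 2) (i : Fin N) : MemLp (fun x => v x i) 2 :=
  (EuclideanSpace.proj i : Sp N →L[ℝ] ℝ).comp_memLp' hv

theorem integrable_coord_mul {v w : Sp N → Sp N} (hv : MemLp v 2) (hw : MemLp w 2) (i j : Fin N) :
    Integrable fun x => v x i * w x j :=
  (memLp_coord hv i).integrable_mul (memLp_coord hw j)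

theorem integrable_norm_sq {v : Sp N → Sp N} (hv : MemLp v 2) : Integrable fun x => ‖v x‖ ^ 2 :=
  hv.integrable_norm_pow (by simp)

theorem integrable_stress {v b : Sp N → Sp N} (hv : MemLp v 2) (hb : MemLp b 2) (i j : Fin N) :
    Integrable (stress v b i j) := by
  refine ((integrable_coord_mul hv hv i j).sub (integrable_coord_mul hb hb i j)).add ?_
  split_ifs
  · exact (integrable_norm_sq hb).const_mul _
  · exact integrable_zero _ _ _

theorem hessPair_stress {v b : ℝ → Sp N → Sp N} {t : ℝ} (hv : MemLp (v t) 2) (hb : MemLp (b t) 2)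
    {ψ : 𝓢(Sp N, ℝ)} (hψ : HasCompactSupport ψ) :
    hessPair (stress (v t) (b t)) (integrable_stress hv hb) ψ =
      tens v v (gradient (ψ : Sp N → ℝ)) t - tens b b (gradient (ψ : Sp N → ℝ)) t
        + 1 / 2 * magn b (gradient (ψ : Sp N → ℝ)) t := by
  have ht : ∀ {u : ℝ → Sp N → Sp N}, MemLp (u t) 2 → tens u u (gradient (ψ : Sp N → ℝ)) t =
      ∑ i, ∑ j, ∫ x, u t x i * u t x j * hess i j ψ x := by
    intro u hu
    have hi : ∀ i j, Integrable fun x => u t x i * u t x j * hess i j ψ x := fun i j =>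
      integrable_mul_schwartz (integrable_coord_mul hu hu i j) _
    simp only [tens, pd_gradient hψ]
    rw [integral_finsetSum _ fun i _ => integrable_finsetSum _ fun j _ => hi i j]
    exact Finset.sum_congr rfl fun i _ => integral_finsetSum _ fun j _ => hi i j
  have hm : 1 / 2 * magn b (gradient (ψ : Sp N → ℝ)) t =
      ∑ i, ∑ j, ∫ x, (if i = j then 1 / 2 * ‖b t x‖ ^ 2 else 0) * hess i j ψ x := by
    have e : ∀ i, ∑ j, ∫ x, (if i = j then 1 / 2 * ‖b t x‖ ^ 2 else 0) * hess i j ψ x =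
        1 / 2 * ∫ x, ‖b t x‖ ^ 2 * hess i i ψ x := by
      intro i
      rw [Finset.sum_eq_single i, ← integral_const_mul]
      · simp [mul_assoc]
      · intro j _ hj
        simp [Ne.symm hj]
      · simp
    simp_rw [e]
    rw [← Finset.mul_sum, ← integral_finsetSum _ fun i _ =>
      integrable_mul_schwartz (integrable_norm_sq hb) _]
    simp only [magn, divg, pd_gradient hψ, Finset.mul_sum]
  rw [hessPair_apply, ht hv, ht hb, hm, ← Finset.sum_sub_distrib, ← Finset.sum_add_distrib]
  refine Finset.sum_congr rfl fun i _ => ?_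
  rw [← Finset.sum_sub_distrib, ← Finset.sum_add_distrib]
  refine Finset.sum_congr rfl fun j _ => ?_
  have h1 := integrable_mul_schwartz (integrable_coord_mul hv hv i j) (hess i j ψ)
  have h2 := integrable_mul_schwartz (integrable_coord_mul hb hb i j) (hess i j ψ)
  have h3 : Integrable fun x => (if i = j then 1 / 2 * ‖b t x‖ ^ 2 else 0) * hess i j ψ x := by
    refine integrable_mul_schwartz ?_ _
    split_ifs
    · exact (integrable_norm_sq hb).const_mul _
    · exact integrable_zero _ _ _
  have h4 : Integrable fun x => v t x i * v t x j * hess i j ψ x - b t x i * b t x j * hess i j ψ x :=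
    h1.sub h2
  rw [← integral_sub h1 h2, ← integral_add h4 h3]
  refine integral_congr_ae (.of_forall fun x => ?_)
  simp only [stress]
  ring

theorem integral_norm_sq_eq_sum {v : Sp N → Sp N} (hv : MemLp v 2) :
    ∫ x, ‖v x‖ ^ 2 = ∑ i, ∫ x, (v x i) ^ 2 := by
  rw [← integral_finsetSum _ fun i _ => (memLp_coord hv i).integrable_sq]
  simp only [EuclideanSpace.norm_sq_eq, Real.norm_eq_abs, sq_abs]

theorem ae_eq_zero_of_integral_norm_sq {v : Sp N → Sp N} (hv : MemLp v 2)
    (h : ∫ x, ‖v x‖ ^ 2 = 0) : ∀ᵐ x, v x = 0 := by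
  rw [integral_eq_zero_iff_of_nonneg (fun x => by positivity) (integrable_norm_sq hv)] at h
  filter_upwards [h] with x hx
  simpa using hx

theorem integral_stress_diag {v b : Sp N → Sp N} (hv : MemLp v 2) (hb : MemLp b 2) (k : Fin N) :
    ∫ x, stress v b k k x =
      (∫ x, (v x k) ^ 2) - (∫ x, (b x k) ^ 2) + 1 / 2 * ∫ x, ‖b x‖ ^ 2 := by
  have e : ∀ x, stress v b k k x = ((v x k) ^ 2 - (b x k) ^ 2) + 1 / 2 * ‖b x‖ ^ 2 := fun x => by
    simp [stress, sq]
  simp_rw [e]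
  have h1 := (memLp_coord hv k).integrable_sq
  have h2 := (memLp_coord hb k).integrable_sq
  have h3 : Integrable fun x => (v x k) ^ 2 - (b x k) ^ 2 := h1.sub h2
  rw [integral_add h3 ((integrable_norm_sq hb).const_mul _), integral_sub h1 h2,
    integral_const_mul]

theorem eq_zero_of_integral_stress_diag (hN : 2 ≤ N) {v b : Sp N → Sp N} (hv : MemLp v 2)
    (hb : MemLp b 2) {c : ℝ} (hc : 0 ≤ c) (h : ∀ k, ∫ x, stress v b k k x = -c) :
    (∀ᵐ x, v x = 0) ∧ (3 ≤ N → ∀ᵐ x, b x = 0) ∧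
      (N = 2 → ∀ i j, ∫ x, (b x i) ^ 2 = ∫ x, (b x j) ^ 2) := by
  simp only [integral_stress_diag hv hb] at h
  set V := ∫ x, ‖v x‖ ^ 2 with hV
  set W := ∫ x, ‖b x‖ ^ 2 with hW
  have hV0 : 0 ≤ V := integral_nonneg fun x => by positivity
  have hW0 : 0 ≤ W := integral_nonneg fun x => by positivity
  -- The trace identity: the coefficient of `W` is `N/2 - 1`, which is nonnegative for `N ≥ 2` and
  -- positive exactly when `N ≥ 3`.
  have hsum : V - W + N * (1 / 2 * W) = -(N * c) := by
    have := Finset.sum_congr rfl fun (k : Fin N) (_ : k ∈ Finset.univ) => h k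
    rw [Finset.sum_add_distrib, Finset.sum_sub_distrib, ← integral_norm_sq_eq_sum hv,
      ← integral_norm_sq_eq_sum hb] at this
    simpa using this
  have hN' : (2 : ℝ) ≤ N := by exact_mod_cast hN
  have hNc : 0 ≤ N * c := by positivity
  have hNW : 0 ≤ (N - 2) * W := mul_nonneg (by linarith) hW0
  have hVz : V = 0 := by nlinarith
  refine ⟨ae_eq_zero_of_integral_norm_sq hv hVz, fun h3 => ?_, fun h2 i j => ?_⟩
  · have h3' : (3 : ℝ) ≤ N := by exact_mod_cast h3
    have hWz : W = 0 := by nlinarith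
    exact ae_eq_zero_of_integral_norm_sq hb hWz
  · have hz : ∀ k, ∫ x, (v x k) ^ 2 = 0 := by
      intro k
      refine integral_eq_zero_of_ae ?_
      filter_upwards [ae_eq_zero_of_integral_norm_sq hv hVz] with x hx
      simp [hx]
    have hi := h i
    have hj := h j
    rw [hz] at hi hj
    linarith

/-- Tonelli's theorem applied to the norm of `u` passes from slices to the product, without asking
for measurability of the exceptional set. -/
theorem ae_prod_eq_zero {T : ℝ} {u : ℝ → Sp N → Sp N}
    (hu : AEStronglyMeasurable (Function.uncurry u) ((volume.restrict (Ioo 0 T)).prod volume))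
    (h : ∀ᵐ t ∂(volume.restrict (Ioo 0 T)), ∀ᵐ x, u t x = 0) :
    ∀ᵐ z : ℝ × Sp N ∂((volume.restrict (Ioo 0 T)).prod volume), u z.1 z.2 = 0 := by
  have h0 : ∫⁻ z, ‖Function.uncurry u z‖ₑ ∂((volume.restrict (Ioo 0 T)).prod volume) = 0 := by
    rw [lintegral_prod _ hu.enorm]
    refine lintegral_eq_zero_of_ae_eq_zero ?_
    filter_upwards [h] with t ht
    refine lintegral_eq_zero_of_ae_eq_zero ?_
    filter_upwards [ht] with x hx
    simp [Function.uncurry, hx]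
  rw [lintegral_eq_zero_iff' hu.enorm] at h0
  filter_upwards [h0] with z hz
  simpa [Function.uncurry] using hz

theorem tens_eq_zero_left {u w : ℝ → Sp N → Sp N} {t : ℝ} (h : ∀ᵐ x, u t x = 0)
    (φ : Sp N → Sp N) : tens u w φ t = 0 := by
  refine integral_eq_zero_of_ae ?_
  filter_upwards [h] with x hx
  simp [hx]

theorem tens_eq_zero_right {u w : ℝ → Sp N → Sp N} {t : ℝ} (h : ∀ᵐ x, w t x = 0)
    (φ : Sp N → Sp N) : tens u w φ t = 0 := by
  refine integral_eq_zero_of_ae ?_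
  filter_upwards [h] with x hx
  simp [hx]

theorem IsWeakSolution.isWeakHeatSolution {μ ν T : ℝ} {v b : ℝ → Sp N → Sp N} {p : ℝ → Distr N}
    (hsol : IsWeakSolution μ ν T v b p)
    (hv : ∀ᵐ t ∂(volume.restrict (Ioo 0 T)), ∀ᵐ x, v t x = 0) : IsWeakHeatSolution μ T b where
  mem := hsol.mem_b
  heat φ ξ hφ hξ := by
    have h := hsol.induction_eq φ ξ hφ hξ
    have z1 : ∫ t in Ioo 0 T, tens v b φ t * ξ t = 0 := by
      refine integral_eq_zero_of_ae ?_
      filter_upwards [hv] with t ht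
      simp [tens_eq_zero_left ht]
    have z2 : ∫ t in Ioo 0 T, tens b v φ t * ξ t = 0 := by
      refine integral_eq_zero_of_ae ?_
      filter_upwards [hv] with t ht
      simp [tens_eq_zero_right ht]
    rw [z1, z2] at h
    linarith

theorem IsWeakSolution.exists_integral_stress_diag {μ ν T : ℝ} {v b : ℝ → Sp N → Sp N}
    {p : ℝ → Distr N} (hN : 2 ≤ N) (hsol : IsWeakSolution μ ν T v b p) {η : 𝓢(Sp N, ℝ)}
    (hη : ∫ x, η x ≠ 0)
    (hp : MemL1L1Plus T p ∨ ∃ q : ℝ, 0 < q ∧ q ≤ 1 ∧ MemL1Hardy η q T p) :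
    ∀ᵐ t ∂(volume.restrict (Ioo 0 T)),
      ∃ c, 0 ≤ c ∧ ∀ k, ∫ x, stress (v t) (b t) k k x = -c := by
  have hN1 : 1 ≤ N := by lia
  rcases hp with ⟨g, hg, hpg, hg0⟩ | ⟨q, hq, hq1, hH⟩
  · choose Ψ hΨ hΨ2 using fun k : Fin N => exists_localSquare hN1 k
    -- The null set of times depends on the test function, so the pressure equation is used only for
    -- countably many: one profile per coordinate and its integer dilates.
    have hid : ∀ᵐ t ∂(volume.restrict (Ioo 0 T)), ∀ (k : Fin N) (n : ℕ), _ :=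
      ae_all_iff.2 fun k => ae_all_iff.2 fun n =>
        hsol.pressure_eq (hasCompactSupport_natDilate (hΨ k) n)
    filter_upwards [hsol.mem_v.memL2, hsol.mem_b.memL2, hpg, hg0, hg.prod_right_ae, hid]
      with t hv hb hpt h0 hgt hidt
    refine ⟨∫ x, g t x, h0, fun k => ?_⟩
    refine integral_diag_eq_neg_of_integrable (integrable_stress hv hb) hgt (hΨ2 k) fun n => ?_
    rw [hessPair_stress hv hb (hasCompactSupport_natDilate (hΨ k) n), ← hidt k n, hpt]
    rfl
  · obtain ⟨χ, _, h, -, h1⟩ := exists_isRadialCutoff hN1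
    -- Countability again: integer scales, centres in a dense sequence and integer truncation radii.
    -- Continuity of `p(t)` then restores all centres and removes the truncation, through
    -- `kernelS_identity`.
    have hid : ∀ᵐ t ∂(volume.restrict (Ioo 0 T)), ∀ n l R : ℕ, _ :=
      ae_all_iff.2 fun n => ae_all_iff.2 fun l => ae_all_iff.2 fun R =>
        hsol.pressure_eq (hasCompactSupport_cutoffMul h.hasCompactSupport h.contDiff
          ((R : ℝ) + 1)⁻¹ (by positivity) (kernelS η ((n : ℝ) + 1) (by positivity)
            (TopologicalSpace.denseSeq (Sp N) l)))
    filter_upwards [hsol.mem_v.memL2, hsol.mem_b.memL2, hH.mem, hid] with t hv hb hHt hidt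
    refine ⟨0, le_rfl, fun k => ?_⟩
    rw [neg_zero]
    refine integral_diag_eq_zero_of_hardy hN1 (integrable_stress hv hb) hη hq hq1 hHt
      (fun n => kernelS_identity _ h.hasCompactSupport h.contDiff h1 fun l R ψ hψ => ?_) k
    subst hψ
    rw [hessPair_stress hv hb (hasCompactSupport_cutoffMul h.hasCompactSupport h.contDiff _ _ _),
      ← hidt n l R]

end MHD

end

theorem theorem3p1 (N : ℕ) (hN : 2 ≤ N) (μ ν T : ℝ) (hμ : 0 ≤ μ) (hν : 0 ≤ ν) (hT : 0 < T)
    (v b : ℝ → MHD.Sp N → MHD.Sp N) (p : ℝ → MHD.Distr N)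
    (hsol : MHD.IsWeakSolution μ ν T v b p)
    (η : 𝓢(MHD.Sp N, ℝ)) (hη : (∫ x, η x) ≠ 0)
    (hp : MHD.MemL1L1Plus T p ∨ ∃ q : ℝ, 0 < q ∧ q ≤ 1 ∧ MHD.MemL1Hardy η q T p) :
    (3 ≤ N → ∀ᵐ z : ℝ × MHD.Sp N ∂((volume.restrict (Ioo 0 T)).prod volume),
      v z.1 z.2 = 0 ∧ b z.1 z.2 = 0) ∧
    (N = 2 →
      (∀ᵐ z : ℝ × MHD.Sp N ∂((volume.restrict (Ioo 0 T)).prod volume), v z.1 z.2 = 0) ∧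
      (∀ᵐ t ∂(volume.restrict (Ioo 0 T)), ∀ i j : Fin N,
        (∫ x, (b t x i) ^ 2) = ∫ x, (b t x j) ^ 2) ∧
      MHD.IsWeakHeatSolution μ T b) := by
  have key : ∀ᵐ t ∂(volume.restrict (Ioo 0 T)), (∀ᵐ x, v t x = 0) ∧ (3 ≤ N → ∀ᵐ x, b t x = 0) ∧
      (N = 2 → ∀ i j, ∫ x, (b t x i) ^ 2 = ∫ x, (b t x j) ^ 2) := by
    filter_upwards [hsol.exists_integral_stress_diag hN hη hp, hsol.mem_v.memL2,
      hsol.mem_b.memL2] with t ⟨c, hc, h⟩ hv hb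
    exact MHD.eq_zero_of_integral_stress_diag hN hv hb hc h
  have hv : ∀ᵐ t ∂(volume.restrict (Ioo 0 T)), ∀ᵐ x, v t x = 0 := key.mono fun t h => h.1
  have hv' := MHD.ae_prod_eq_zero hsol.mem_v.meas hv
  refine ⟨fun h3 => ?_, fun h2 => ⟨hv', key.mono fun t h => h.2.2 h2,
    hsol.isWeakHeatSolution hv⟩⟩
  exact hv'.and (MHD.ae_prod_eq_zero hsol.mem_b.meas (key.mono fun t h => h.2.1 h3))
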